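/- Let $\mathcal{P}$ be a set of parameters, $\mathcal{X}$ a space of data items and $f:\mathcal{P}\times\mathcal{X}\to[0,\infty)$ an arbitrary cost function. For a finite $Y\subset\mathcal{X}$ with weights $w\ge 0$ and $t\ge 0$, let $$f_t(\theta,Y)=\min_u \sum_{x\in Y}(w(x)-u(x))\,f(\theta,x),$$ where the minimum is over all $u$ with $0\le u(x)\le w(x)$ for $x\in Y$ and $\sum_{x\in Y}u(x)=\min\{t,\sum_{x\in Y}w(x)\}$. This is the least cost that is left after outliers of total weight $t$ are removed; items may be removed in part, and everything is removed if $t$ exceeds the total weight. If all weights are equal and some subset of $Y$ has total weight $t$, it is $\min\{\sum_{x\in Y\setminus O}w(x)f(\theta,x): O\subseteq Y,\ w(O)=t\}$. Let $X\subset\mathcal{X}$ be a finite set of $n$ items with unit weights and let $z$ be an integer with $1\le z\le n$. Let $\mathfrak{R}$ be the collection of all sets $\{x\in\mathcal{X}: f(\theta,x)\le r\}$ with $\theta\in\mathcal{P}$, $r\ge 0$. A nonempty set $C\subseteq X$ is a $\delta$-sample of $X$ if $\big|\,|X\cap R|/|X|-|C\cap R|/|C|\,\big|\le\delta$ for all $R\in\mathfrak{R}$.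 Every such $C$ is given the weights $w(c)=n/|C|$. 1. If $0<\delta\le z/n$ and $C$ is a $\delta$-sample of $X$, then for every $\theta\in\mathcal{P}$ $$f_{z+\delta n}(\theta,X)\le f_z(\theta,C)\le f_{z-\delta n}(\theta,X).$$ 2. Let $0<\beta<1$ and $\delta=\beta z/n$. Every $\delta$-sample $C$ of $X$ is a $(\beta,0)$-robust coreset of $X$, that is, $f_{(1+\beta)z}(\theta,X)\le f_z(\theta,C)\le f_{(1-\beta)z}(\theta,X)$ for all $\theta\in\mathcal{P}$. 3. There is an absolute constant $K>0$ such that the following holds for all such $f$, $X$, $z$, $\beta$ and all $\eta\in(0,1)$. If $(\mathcal{X},\mathfrak{R})$ has finite VC dimension $\mathtt{vcdim}$ and $m\le n$ is an integer with $$m\ \ge\ \min\Big\{n,\ \frac{K}{\beta^2}\Big(\frac nz\Big)^2\Big(\mathtt{vcdim}+\log\frac1\eta\Big)\Big\},$$ then a uniformly random $m$-element subset $C$ of $X$ is, with probability at least $1-\eta$, a $\beta z/n$-sample of $X$ and a $(\beta,0)$-robust coreset of $X$. -/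

import Mathlib

/-- The weighted objective `f(θ, Y) = ∑_{x ∈ Y} w(x) f(θ, x)` of a finite data set `Y` with weights
`w`, for a cost function `f`. -/
def weightedCost {Θ 𝒳 : Type*} (f : Θ → 𝒳 → ℝ) (w : 𝒳 → ℝ) (θ : Θ) (Y : Finset 𝒳) : ℝ :=
  ∑ x ∈ Y, w x * f θ x

/-- `u` describes a removal of outliers of total weight `t` from the data set `Y` with weights `w`:
the amount `u x` is removed from the weight of the item `x`. An item may be removed in part, because
in a weighted data set there need not be any subset of total weight exactly `t`. If `t` exceeds the
total weight of `Y`, everything is removed. -/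
def IsOutlierRemoval {𝒳 : Type*} (w : 𝒳 → ℝ) (Y : Finset 𝒳) (t : ℝ) (u : 𝒳 → ℝ) : Prop :=
  (∀ x ∈ Y, 0 ≤ u x ∧ u x ≤ w x) ∧ ∑ x ∈ Y, u x = min t (∑ x ∈ Y, w x)

/-- The robust (trimmed) objective `f_t(θ, Y)`: the least weighted cost that is left after outliers
of total weight `t` are removed from `Y`. -/
noncomputable def trimmedCost {Θ 𝒳 : Type*} (f : Θ → 𝒳 → ℝ) (w : 𝒳 → ℝ) (t : ℝ) (θ : Θ)
    (Y : Finset 𝒳) : ℝ :=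
  sInf {v | ∃ u : 𝒳 → ℝ, IsOutlierRemoval w Y t u ∧ v = weightedCost f (fun x => w x - u x) θ Y}

open Classical in
/-- If all items of `Y` have the same weight `c` and `t = c * k` is the total weight of `k` items,
then `f_t(θ, Y)` is the minimum of `f(θ, Y \ O)` over the subsets `O` of `Y` of total weight `t`:
partial removals bring no gain. -/
theorem isLeast_trimmedCost {Θ 𝒳 : Type*} (f : Θ → 𝒳 → ℝ) (c : ℝ) (hc : 0 ≤ c) (θ : Θ)
    (Y : Finset 𝒳) (k : ℕ) (hk : k ≤ Y.card) :
    IsLeast {v | ∃ O ⊆ Y, O.card = k ∧ v = weightedCost f (fun _ => c) θ (Y \ O)}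
      (trimmedCost f (fun _ => c) (c * k) θ Y) := by
  have hk' : (k : ℝ) ≤ Y.card := by exact_mod_cast hk
  have hmin : min (c * k) (∑ _x ∈ Y, c) = c * k := by
    rw [Finset.sum_const, nsmul_eq_mul]
    exact min_eq_left (by nlinarith)
  obtain ⟨O, hO, hmax⟩ := Finset.exists_max_image (Y.powersetCard k) (fun O => ∑ x ∈ O, f θ x)
    (Finset.powersetCard_nonempty.2 hk)
  rw [Finset.mem_powersetCard] at hO
  obtain ⟨hOY, hOk⟩ := hO
  have hex : ∀ x ∈ Y \ O, ∀ y ∈ O, f θ x ≤ f θ y := by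
    intro x hx y hy
    rw [Finset.mem_sdiff] at hx
    have hxe : x ∉ O.erase y := fun h => hx.2 (Finset.mem_of_mem_erase h)
    have h1 := hmax (insert x (O.erase y)) (by
      rw [Finset.mem_powersetCard]
      refine ⟨Finset.insert_subset hx.1 ((Finset.erase_subset _ _).trans hOY), ?_⟩
      rw [Finset.card_insert_of_notMem hxe, Finset.card_erase_add_one hy, hOk])
    simp only [Finset.sum_insert hxe] at h1
    have h2 := Finset.add_sum_erase O (fun x => f θ x) hy
    linarith
  obtain ⟨τ, hτ1, hτ2⟩ : ∃ τ : ℝ, (∀ x ∈ Y \ O, f θ x ≤ τ) ∧ ∀ y ∈ O, τ ≤ f θ y := by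
    rcases O.eq_empty_or_nonempty with h | h
    · subst h
      refine ⟨∑ x ∈ Y, |f θ x|, fun x hx => ?_, by simp⟩
      have hx' : x ∈ Y := by simpa using hx
      exact (le_abs_self _).trans
        (Finset.single_le_sum (f := fun x => |f θ x|) (fun _ _ => abs_nonneg _) hx')
    · exact ⟨O.inf' h (f θ), fun x hx => (Finset.le_inf'_iff _ _).2 (hex x hx),
        fun y hy => Finset.inf'_le _ hy⟩
  have hle : ∀ u : 𝒳 → ℝ, IsOutlierRemoval (fun _ => c) Y (c * k) u →
      weightedCost f (fun _ => c) θ (Y \ O) ≤ weightedCost f (fun x => c - u x) θ Y := by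
    intro u hu
    obtain ⟨hu1, hu2⟩ := hu
    simp only at hu1 hu2
    rw [hmin] at hu2
    unfold weightedCost
    have e1 : ∑ x ∈ Y \ O, c * (f θ x - τ) ≤ ∑ x ∈ Y \ O, (c - u x) * (f θ x - τ) := by
      refine Finset.sum_le_sum fun x hx => ?_
      have := hτ1 x hx
      have := (hu1 x (Finset.mem_sdiff.1 hx).1).1
      nlinarith
    have e2 : 0 ≤ ∑ x ∈ O, (c - u x) * (f θ x - τ) := by
      refine Finset.sum_nonneg fun x hx => ?_
      have := hτ2 x hx
      have := (hu1 x (hOY hx)).2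
      nlinarith
    have e3 := Finset.sum_sdiff (f := fun x => (c - u x) * (f θ x - τ)) hOY
    have e4 : ∑ x ∈ Y, (c - u x) * (f θ x - τ)
        = ∑ x ∈ Y, (c - u x) * f θ x - (c * Y.card - c * k) * τ := by
      simp only [mul_sub, Finset.sum_sub_distrib, ← Finset.sum_mul, hu2, Finset.sum_const,
        nsmul_eq_mul]
      ring
    have e5 : ∑ x ∈ Y \ O, c * (f θ x - τ)
        = ∑ x ∈ Y \ O, c * f θ x - (c * Y.card - c * k) * τ := by
      simp only [mul_sub, Finset.sum_sub_distrib, Finset.sum_const, nsmul_eq_mul,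
        Finset.cast_card_sdiff hOY, hOk]
      ring
    linarith
  have hrem : ∀ Q ⊆ Y, Q.card = k →
      IsOutlierRemoval (fun _ => c) Y (c * k) (fun x => if x ∈ Q then c else 0) ∧
      weightedCost f (fun _ => c) θ (Y \ Q)
        = weightedCost f (fun x => c - if x ∈ Q then c else 0) θ Y := by
    intro Q hQ hQk
    refine ⟨⟨fun x _ => by dsimp only; split_ifs <;> simp [hc], ?_⟩, ?_⟩
    · rw [hmin, Finset.sum_ite_mem, Finset.inter_eq_right.2 hQ, Finset.sum_const, nsmul_eq_mul,
        hQk, mul_comm]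
    · unfold weightedCost
      rw [← Finset.sum_sdiff hQ]
      have h1 : ∑ x ∈ Q, (c - if x ∈ Q then c else 0) * f θ x = 0 :=
        Finset.sum_eq_zero fun x hx => by simp [hx]
      rw [h1, add_zero]
      exact Finset.sum_congr rfl fun x hx => by simp [(Finset.mem_sdiff.1 hx).2]
  have hval : trimmedCost f (fun _ => c) (c * k) θ Y = weightedCost f (fun _ => c) θ (Y \ O) := by
    have : IsLeast {v | ∃ u : 𝒳 → ℝ, IsOutlierRemoval (fun _ => c) Y (c * k) u ∧
        v = weightedCost f (fun x => c - u x) θ Y} (weightedCost f (fun _ => c) θ (Y \ O)) := by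
      refine ⟨⟨_, hrem O hOY hOk⟩, ?_⟩
      rintro v ⟨u, hu, rfl⟩
      exact hle u hu
    exact this.csInf_eq
  rw [hval]
  refine ⟨⟨O, hOY, hOk, rfl⟩, ?_⟩
  rintro v ⟨Q, hQ, hQk, rfl⟩
  obtain ⟨h1, h2⟩ := hrem Q hQ hQk
  rw [h2]
  exact hle _ h1

/-- The ranges of the `f`-induced range space: all sets `{x | f(θ, x) ≤ r}` with `r ≥ 0`. -/
def inducedRanges {Θ 𝒳 : Type*} (f : Θ → 𝒳 → ℝ) : Set (Set 𝒳) :=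
  {R | ∃ (θ : Θ) (r : ℝ), 0 ≤ r ∧ R = {x | f θ x ≤ r}}

open Classical in
/-- `C` is a `δ`-sample of the finite set `X` in a range space with set of ranges `𝓡`. -/
def IsDeltaSample {𝒳 : Type*} (𝓡 : Set (Set 𝒳)) (δ : ℝ) (C X : Finset 𝒳) : Prop :=
  C ⊆ X ∧ C.Nonempty ∧ ∀ R ∈ 𝓡,
    |((X.filter (· ∈ R)).card : ℝ) / X.card - ((C.filter (· ∈ R)).card : ℝ) / C.card| ≤ δ

/-- A finite set `S` is shattered by `𝓡`: every subset of `S` is the trace of a range. -/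
def ShatteredBy {𝒳 : Type*} (𝓡 : Set (Set 𝒳)) (S : Finset 𝒳) : Prop :=
  ∀ T ⊆ S, ∃ R ∈ 𝓡, (S : Set 𝒳) ∩ R = T

/-- The VC dimension of a range space: the largest size of a shattered finite set (possibly `∞`). -/
noncomputable def rangeVCDim {𝒳 : Type*} (𝓡 : Set (Set 𝒳)) : ℕ∞ :=
  ⨆ (S : Finset 𝒳) (_ : ShatteredBy 𝓡 S), (S.card : ℕ∞)

/-- The data set `C` with weights `w` is a `(β, ε)`-robust coreset, for all parameters, of the data
set `X` of unit weights with `z` outliers. -/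
def IsRobustCoreset {Θ 𝒳 : Type*} (f : Θ → 𝒳 → ℝ) (z β ε : ℝ) (C : Finset 𝒳) (w : 𝒳 → ℝ)
    (X : Finset 𝒳) : Prop :=
  ∀ θ : Θ,
    (1 - ε) * trimmedCost f (fun _ => 1) ((1 + β) * z) θ X ≤ trimmedCost f w z θ C ∧
    trimmedCost f w z θ C ≤ (1 + ε) * trimmedCost f (fun _ => 1) ((1 - β) * z) θ X

open Classical in
/-- The probability that a uniformly random `m`-element subset `C` of `X` (a uniform sample of `m`
items, without repetition) has the property `p`. -/
noncomputable def uniformSampleProb {𝒳 : Type*} (X : Finset 𝒳) (m : ℕ) (p : Finset 𝒳 → Prop) : ℝ :=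
  (((X.powersetCard m).filter p).card : ℝ) / (X.powersetCard m).card

/-! The deterministic half rests on linear programming duality: the trimmed cost is the maximum over
`τ ≥ 0` of `∑ w x * min (f θ x) τ - t * τ`, the optimal `τ` being a quantile of the costs
(`le_trimmedCost`, `exists_trimmedCost_le`). By the layer-cake formula a truncated sum is an
integral over `0 ≤ r ≤ τ` of counts of the ranges `{f θ ≤ r}`, so a `δ`-sample changes it by at most
`δ n τ` (`IsDeltaSample.abs_sum_min_sub_le`). Moving `t` by `δ n` changes the dual objective by
exactly this amount, which gives both inequalities with no multiplicative error.

The probabilistic half is the uniform law for VC classes without a logarithmic loss, for sampling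
without repetition. A deviating sample is compared with a disjoint ghost sample (`card_ghost_le`).
Pairs of disjoint samples are injections of `ι ⊕ ι`, a family invariant under swapping the two
copies of any index, so random signs may be inserted (`card_exists_lt_abs_halvesDiff_le`). The
resulting Rademacher process is bounded by chaining (`card_exists_lt_abs_signedSum_le`) along nets
whose logarithmic size grows only linearly in the level, by Dudley's packing bound
(`log_card_le_of_separated`).

A ghost sample needs `2 m ≤ n`; larger samples are handled through their complements. VC dimension
zero and `m = n` are treated directly. -/

/-! ### Sub-Gaussian tails of random signed sums. -/

section Rademacher

open Finset

/-- The sign attached to a Boolean: `true` stands for a swap. -/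
def boolSign (b : Bool) : ℝ := if b then -1 else 1

variable {ι : Type*} [Fintype ι] [DecidableEq ι]

/-- The sum factors over the coordinates, each factor being `2 cosh (v i)`, and `cosh x ≤ exp (x² /
2)`. -/
theorem sum_exp_boolSign_le (v : ι → ℝ) :
    ∑ σ : ι → Bool, Real.exp (∑ i, boolSign (σ i) * v i)
      ≤ 2 ^ Fintype.card ι * Real.exp ((∑ i, v i ^ 2) / 2) := by
  have h := Finset.prod_univ_sum (fun _ : ι => (univ : Finset Bool))
    (fun i b => Real.exp (boolSign b * v i))
  rw [Fintype.piFinset_univ] at h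
  simp_rw [Real.exp_sum]
  rw [← h, Finset.sum_div, Real.exp_sum, ← Finset.card_univ, ← Finset.prod_const,
    ← Finset.prod_mul_distrib]
  refine Finset.prod_le_prod (fun i _ => Finset.sum_nonneg fun b _ => (Real.exp_pos _).le) ?_
  intro i _
  have := Real.cosh_le_exp_half_sq (v i)
  rw [Real.cosh_eq] at this
  simp only [Fintype.sum_bool, boolSign, if_true, Bool.false_eq_true, if_false, neg_one_mul,
    one_mul]
  linarith

theorem card_lt_sum_boolSign_le (v : ι → ℝ) {V s : ℝ} (hV : 0 < V) (hv : ∑ i, v i ^ 2 ≤ V)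
    (hs : 0 ≤ s) :
    (#{σ : ι → Bool | s < ∑ i, boolSign (σ i) * v i} : ℝ)
      ≤ 2 ^ Fintype.card ι * Real.exp (-(s ^ 2 / (2 * V))) := by
  -- Markov's inequality for the exponential moment; the parameter `λ = s / V` minimises `λ² V / 2 -
  -- λ s`.
  have h1 := sum_exp_boolSign_le (fun i => s / V * v i)
  have h2 : (#{σ : ι → Bool | s < ∑ i, boolSign (σ i) * v i} : ℝ) * Real.exp (s / V * s)
      ≤ ∑ σ : ι → Bool, Real.exp (∑ i, boolSign (σ i) * (s / V * v i)) := by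
    rw [← nsmul_eq_mul, ← Finset.sum_const]
    refine (Finset.sum_le_sum fun σ hσ => ?_).trans
      (Finset.sum_le_sum_of_subset_of_nonneg (Finset.subset_univ _)
        fun _ _ _ => (Real.exp_pos _).le)
    rw [Finset.mem_filter] at hσ
    rw [Real.exp_le_exp]
    calc s / V * s ≤ s / V * ∑ i, boolSign (σ i) * v i :=
          mul_le_mul_of_nonneg_left hσ.2.le (by positivity)
      _ = _ := by rw [Finset.mul_sum]; exact Finset.sum_congr rfl fun i _ => by ring
  have h3 : (∑ i, (s / V * v i) ^ 2) / 2 ≤ s ^ 2 / (2 * V) := by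
    have : ∑ i, (s / V * v i) ^ 2 = (s / V) ^ 2 * ∑ i, v i ^ 2 := by
      rw [Finset.mul_sum]; exact Finset.sum_congr rfl fun i _ => by ring
    rw [this]
    calc (s / V) ^ 2 * (∑ i, v i ^ 2) / 2 ≤ (s / V) ^ 2 * V / 2 := by gcongr
      _ = _ := by field_simp
  have h4 := h2.trans (h1.trans
    (mul_le_mul_of_nonneg_left (Real.exp_le_exp.2 h3) (by positivity)))
  have h5 : Real.exp (s ^ 2 / (2 * V))
      = Real.exp (-(s ^ 2 / (2 * V))) * Real.exp (s / V * s) := by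
    rw [← Real.exp_add]; congr 1; field_simp; ring
  rw [h5, ← mul_assoc] at h4
  exact le_of_mul_le_mul_right h4 (Real.exp_pos _)

theorem card_lt_abs_sum_boolSign_le (v : ι → ℝ) {V s : ℝ} (hV : 0 < V)
    (hv : ∑ i, v i ^ 2 ≤ V) (hs : 0 ≤ s) :
    (#{σ : ι → Bool | s < |∑ i, boolSign (σ i) * v i|} : ℝ)
      ≤ 2 ^ Fintype.card ι * (2 * Real.exp (-(s ^ 2 / (2 * V)))) := by
  have h1 := card_lt_sum_boolSign_le v hV hv hs
  have h2 := card_lt_sum_boolSign_le (fun i => -v i) hV (by simpa using hv) hs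
  have h3 : (#{σ : ι → Bool | s < |∑ i, boolSign (σ i) * v i|} : ℝ)
      ≤ #{σ : ι → Bool | s < ∑ i, boolSign (σ i) * v i}
        + #{σ : ι → Bool | s < ∑ i, boolSign (σ i) * -v i} := by
    norm_cast
    refine (Finset.card_le_card ?_).trans (Finset.card_union_le _ _)
    intro σ
    simp only [Finset.mem_filter, Finset.mem_univ, true_and, Finset.mem_union, lt_abs, mul_neg,
      Finset.sum_neg_distrib, imp_self]
  linarith

end Rademacher

/-! ### Packing numbers of set families of bounded VC dimension. -/

section Packing

open Finset

/-- Since `y ^ d ≤ y ^ i` for `i ≤ d`, multiplying by `y ^ d` leaves at most `(1 + y) ^ k ≤ exp (y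
k)`. The parameter `y` stays free so that the packing bound can tune it. -/
theorem sum_choose_le_mul_exp (k d : ℕ) {y : ℝ} (hy : 0 < y) (hy1 : y ≤ 1) :
    (∑ i ∈ Iic d, (k.choose i : ℝ)) ≤ (y ^ d)⁻¹ * Real.exp (y * k) := by
  rw [inv_mul_eq_div, le_div_iff₀ (by positivity), Finset.sum_mul]
  have h1 : ∑ i ∈ Iic d, (k.choose i : ℝ) * y ^ d ≤ ∑ i ∈ Iic d, (k.choose i : ℝ) * y ^ i := by
    refine Finset.sum_le_sum fun i hi => mul_le_mul_of_nonneg_left ?_ (by positivity)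
    exact pow_le_pow_of_le_one hy.le hy1 (Finset.mem_Iic.1 hi)
  have h2 : ∑ i ∈ Iic d, (k.choose i : ℝ) * y ^ i
      ≤ ∑ i ∈ range (k + 1), (k.choose i : ℝ) * y ^ i := by
    have : ∑ i ∈ Iic d, (k.choose i : ℝ) * y ^ i
        = ∑ i ∈ (Iic d).filter (· < k + 1), (k.choose i : ℝ) * y ^ i := by
      rw [Finset.sum_filter]
      refine Finset.sum_congr rfl fun i _ => ?_
      split_ifs with h
      · rfl
      · rw [Nat.choose_eq_zero_of_lt (by omega)]; simp
    rw [this]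
    refine Finset.sum_le_sum_of_subset_of_nonneg ?_ fun _ _ _ => by positivity
    intro i hi
    simpa using (Finset.mem_filter.1 hi).2
  have h3 : ∑ i ∈ range (k + 1), (k.choose i : ℝ) * y ^ i = (y + 1) ^ k := by
    rw [add_pow]
    exact Finset.sum_congr rfl fun i _ => by simp [mul_comm]
  have h4 : (y + 1) ^ k ≤ Real.exp (y * k) := by
    rw [mul_comm, Real.exp_nat_mul]
    exact pow_le_pow_left₀ (by positivity) (Real.add_one_le_exp y) _
  linarith

variable {α β : Type*} [DecidableEq α] [DecidableEq β] [Fintype β]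

/-- Pulling a set family back along a map does not increase its VC dimension. -/
theorem vcDim_image_preimage_le (𝒜 : Finset (Finset α)) (g : β → α) :
    (𝒜.image fun A => ({b | g b ∈ A} : Finset β)).vcDim ≤ 𝒜.vcDim := by
  unfold Finset.vcDim
  refine Finset.sup_le fun S hS => ?_
  rw [Finset.mem_shatterer] at hS
  have key : ∀ T ⊆ S, ∃ A ∈ 𝒜, ∀ b ∈ S, b ∈ T ↔ g b ∈ A := by
    intro T hT
    obtain ⟨U, hU, hUT⟩ := hS hT
    obtain ⟨A, hA, rfl⟩ := Finset.mem_image.1 hU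
    refine ⟨A, hA, fun b hb => ?_⟩
    rw [← hUT]
    simp [hb]
  -- Two points with the same image lie in the same pullbacks, so a shattered set cannot contain
  -- both.
  have hinj : Set.InjOn g S := by
    intro a ha b hb hab
    obtain ⟨A, _, h⟩ := key {a} (by simpa using ha)
    have h1 := (h a ha).1 (by simp)
    rw [hab] at h1
    have h2 := (h b hb).2 h1
    exact (Finset.mem_singleton.1 h2).symm
  rw [← Finset.card_image_of_injOn hinj]
  refine Finset.Shatters.card_le_vcDim (fun T hT => ?_)
  obtain ⟨A, hA, h⟩ := key (S.filter fun b => g b ∈ T) (Finset.filter_subset _ _)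
  refine ⟨A, hA, ?_⟩
  ext a
  simp only [Finset.mem_inter, Finset.mem_image]
  constructor
  · rintro ⟨⟨b, hb, rfl⟩, hA'⟩
    exact (Finset.mem_filter.1 ((h b hb).2 hA')).2
  · intro ha
    obtain ⟨b, hb, rfl⟩ := Finset.mem_image.1 (hT ha)
    exact ⟨⟨b, hb, rfl⟩, (h b hb).1 (Finset.mem_filter.2 ⟨hb, ha⟩)⟩

variable [Fintype α]

/-- If all distinct members of `𝒜` differ on more than a fraction `ε` of the points, then some
`k`-tuple of points distinguishes all of them as soon as `|𝒜|² exp (-ε k) ≤ 1`. -/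
theorem exists_tuple_injOn (𝒜 : Finset (Finset α)) (h𝒜 : 𝒜.Nonempty) {ε : ℝ}
    (hsep : ∀ A ∈ 𝒜, ∀ B ∈ 𝒜, A ≠ B → ε * Fintype.card α < #(symmDiff A B)) (k : ℕ)
    (hk : (#𝒜 : ℝ) ^ 2 * Real.exp (-(ε * k)) ≤ 1) [Nonempty α] :
    ∃ g : Fin k → α, Set.InjOn (fun A => ({b | g b ∈ A} : Finset (Fin k)))
      (𝒜 : Set (Finset α)) := by
  by_contra hcon
  push Not at hcon
  -- The tuples that miss the symmetric difference of a pair. If no tuple is good, these sets cover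
  -- everything; the count fails strictly because `offDiag` has fewer than `|𝒜|²` pairs.
  set bad : Finset α × Finset α → Finset (Fin k → α) := fun P =>
    Fintype.piFinset fun _ => (symmDiff P.1 P.2)ᶜ with hbad
  have hcover : (univ : Finset (Fin k → α)) ⊆ 𝒜.offDiag.biUnion bad := by
    intro g _
    have := hcon g
    unfold Set.InjOn at this
    push Not at this
    obtain ⟨A, hA, B, hB, hAB, hne⟩ := this
    refine Finset.mem_biUnion.2 ⟨(A, B), Finset.mem_offDiag.2 ⟨hA, hB, hne⟩, ?_⟩
    rw [hbad, Fintype.mem_piFinset]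
    intro b
    have hb := Finset.ext_iff.1 hAB b
    simp only [Finset.mem_filter, Finset.mem_univ, true_and] at hb
    simp only [Finset.mem_compl, Finset.mem_symmDiff]
    tauto
  have hN : (0 : ℝ) < Fintype.card α := by exact_mod_cast Fintype.card_pos
  have hbc : ∀ P ∈ 𝒜.offDiag,
      (#(bad P) : ℝ) ≤ (Fintype.card α : ℝ) ^ k * Real.exp (-(ε * k)) := by
    intro P hP
    obtain ⟨hA, hB, hne⟩ := Finset.mem_offDiag.1 hP
    have h1 := hsep _ hA _ hB hne
    rw [hbad, Fintype.card_piFinset_const, Nat.cast_pow, Finset.card_compl,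
      Nat.cast_sub (Finset.card_le_univ _)]
    have h2 : -(ε * k) = k * -ε := by ring
    rw [h2, Real.exp_nat_mul, ← mul_pow]
    have h3 := Real.add_one_le_exp (-ε)
    have h4 : ((#(symmDiff P.1 P.2) : ℕ) : ℝ) ≤ Fintype.card α := by
      exact_mod_cast Finset.card_le_univ _
    refine pow_le_pow_left₀ (by linarith) ?_ _
    nlinarith
  have hcard : ((Fintype.card α : ℝ)) ^ k
      ≤ #𝒜.offDiag * ((Fintype.card α : ℝ) ^ k * Real.exp (-(ε * k))) := by
    calc ((Fintype.card α : ℝ)) ^ k = #(univ : Finset (Fin k → α)) := by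
          simp
      _ ≤ #(𝒜.offDiag.biUnion bad) := by exact_mod_cast Finset.card_le_card hcover
      _ ≤ ∑ P ∈ 𝒜.offDiag, (#(bad P) : ℝ) := by exact_mod_cast Finset.card_biUnion_le
      _ ≤ _ := by
          rw [← nsmul_eq_mul]
          exact Finset.sum_le_card_nsmul _ _ _ hbc
  have hoff : (#𝒜.offDiag : ℝ) < (#𝒜 : ℝ) ^ 2 := by
    rw [Finset.offDiag_card, sq]
    have := h𝒜.card_pos
    have h1 : #𝒜 * #𝒜 - #𝒜 < #𝒜 * #𝒜 := Nat.sub_lt (by positivity) this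
    exact_mod_cast h1
  have hpos : 0 < (Fintype.card α : ℝ) ^ k * Real.exp (-(ε * k)) := by positivity
  have h1 := mul_lt_mul_of_pos_right hoff hpos
  have h2 : (#𝒜 : ℝ) ^ 2 * ((Fintype.card α : ℝ) ^ k * Real.exp (-(ε * k)))
      ≤ (Fintype.card α : ℝ) ^ k := by
    have := mul_le_mul_of_nonneg_left hk (by positivity : (0:ℝ) ≤ (Fintype.card α : ℝ) ^ k)
    linarith
  linarith

/-- Dudley's packing bound: a family of VC dimension at most `d` whose members pairwise differ on
more than a fraction `ε` of the points has at most `√e (4 / ε) ^ (2 d)` members. -/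
theorem log_card_le_of_separated (𝒜 : Finset (Finset α)) {d : ℕ} (hd : 𝒜.vcDim ≤ d)
    (h𝒜 : 𝒜.Nonempty) {ε : ℝ} (hε : 0 < ε) (hε1 : ε ≤ 1)
    (hsep : ∀ A ∈ 𝒜, ∀ B ∈ 𝒜, A ≠ B → ε * Fintype.card α < #(symmDiff A B)) :
    Real.log #𝒜 ≤ 2 * d * Real.log (4 / ε) + 1 / 2 := by
  have hM : (0 : ℝ) < #𝒜 := by exact_mod_cast h𝒜.card_pos
  have hM1 : (1 : ℝ) ≤ #𝒜 := by exact_mod_cast h𝒜.card_pos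
  have hlog4 : 0 ≤ Real.log (4 / ε) := Real.log_nonneg (by rw [le_div_iff₀ hε]; linarith)
  rcases isEmpty_or_nonempty α with he | hne
  · have : #𝒜 ≤ 1 := by
      refine Finset.card_le_one.2 fun A _ B _ => Finset.ext fun a => (he.false a).elim
    have h1 : #𝒜 = 1 := le_antisymm this h𝒜.card_pos
    rw [h1]
    simp only [Nat.cast_one, Real.log_one]
    positivity
  set k := ⌈2 * Real.log #𝒜 / ε⌉₊ with hk
  have hl := Real.log_nonneg hM1
  have hk1 : 2 * Real.log #𝒜 / ε ≤ k := Nat.le_ceil _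
  have hk2 : (k : ℝ) < 2 * Real.log #𝒜 / ε + 1 := Nat.ceil_lt_add_one (by positivity)
  obtain ⟨g, hg⟩ := exists_tuple_injOn 𝒜 h𝒜 hsep k (by
    rw [div_le_iff₀ hε] at hk1
    rw [← Real.exp_log hM, ← Real.exp_nat_mul, ← Real.exp_add, Real.exp_le_one_iff]
    push_cast
    linarith)
  have h1 : (#𝒜 : ℝ) ≤ ∑ i ∈ Iic d, (k.choose i : ℝ) := by
    rw [← Finset.card_image_of_injOn hg]
    have h2 := (Finset.card_le_card_shatterer
      (𝒜.image fun A => ({b | g b ∈ A} : Finset (Fin k)))).trans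
      Finset.card_shatterer_le_sum_vcDim
    have h3 := (vcDim_image_preimage_le 𝒜 g).trans hd
    have h4 := h2.trans (Finset.sum_le_sum_of_subset (Finset.Iic_subset_Iic.2 h3))
    rw [Fintype.card_fin] at h4
    exact_mod_cast h4
  -- With `y = ε / 4` the term `y k` is at most `log |𝒜| / 2 + 1 / 4`, and half of the logarithm is
  -- absorbed on the left.
  have h2 := h1.trans (sum_choose_le_mul_exp k d (y := ε / 4) (by positivity) (by linarith))
  have h3 := Real.log_le_log hM h2
  rw [Real.log_mul (by positivity) (Real.exp_pos _).ne', Real.log_exp, Real.log_inv, Real.log_pow]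
    at h3
  have h4 : Real.log (4 / ε) = -Real.log (ε / 4) := by
    rw [← Real.log_inv, inv_div]
  have h5 : ε / 4 * k ≤ Real.log #𝒜 / 2 + 1 / 4 := by
    have := mul_le_mul_of_nonneg_left hk2.le (by positivity : 0 ≤ ε / 4)
    have h6 : ε / 4 * (2 * Real.log #𝒜 / ε + 1) = Real.log #𝒜 / 2 + ε / 4 := by
      field_simp
      ring
    linarith
  rw [h4]
  linarith

/-- A set family has nets at scale `4⁻ʲ` whose size is controlled by its VC dimension. -/
theorem exists_net (𝒜 : Finset (Finset α)) {d : ℕ} (hd : 𝒜.vcDim ≤ d) (hd1 : 1 ≤ d) (j : ℕ) :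
    ∃ P ⊆ 𝒜, (#P : ℝ) ≤ Real.exp (4 * d * (j + 1)) ∧
      ∀ A ∈ 𝒜, ∃ B ∈ P, (#(symmDiff A B) : ℝ) ≤ (1 / 4) ^ j * Fintype.card α := by
  classical
  set ε : ℝ := (1 / 4) ^ j with hε
  have hε0 : 0 < ε := by positivity
  have hε1 : ε ≤ 1 := pow_le_one₀ (by norm_num) (by norm_num)
  -- A separated subfamily of maximal size is a net: a member far from all of it could be added.
  obtain ⟨P, hP, hmax⟩ := Finset.exists_max_image
    (𝒜.powerset.filter fun P => ∀ A ∈ P, ∀ B ∈ P, A ≠ B →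
      ε * Fintype.card α < #(symmDiff A B)) card ⟨∅, by simp⟩
  rw [Finset.mem_filter, Finset.mem_powerset] at hP
  refine ⟨P, hP.1, ?_, ?_⟩
  · rcases P.eq_empty_or_nonempty with h | h
    · subst h
      simp [(Real.exp_pos _).le]
    · have h0 := log_card_le_of_separated P ((Finset.vcDim_mono hP.1).trans hd) h hε0 hε1 hP.2
      have h1 : (0 : ℝ) < #P := by exact_mod_cast h.card_pos
      rw [← Real.log_le_iff_le_exp h1]
      have h2 : 4 / ε = 4 ^ (j + 1) := by rw [hε, one_div, inv_pow, pow_succ]; field_simp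
      have h3 : Real.log 4 ≤ 3 / 2 := by
        have : (4 : ℝ) = 2 ^ 2 := by norm_num
        rw [this, Real.log_pow]
        have := Real.log_two_lt_d9
        push_cast
        linarith
      rw [h2, Real.log_pow] at h0
      push_cast at h0
      -- Here `d ≥ 1` is what absorbs the additive `1 / 2`: `3 d (j + 1) + 1 / 2 ≤ 4 d (j + 1)`.
      have h4 : (1 : ℝ) ≤ d := by exact_mod_cast hd1
      have h5 : (0 : ℝ) ≤ j := by positivity
      have h6 : (d : ℝ) * (j + 1) * Real.log 4 ≤ d * (j + 1) * (3 / 2) := by gcongr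
      nlinarith
  · intro A hA
    by_contra! hcon
    have hAP : A ∉ P := fun h => by
      have := hcon A h
      rw [symmDiff_self] at this
      simp only [Finset.bot_eq_empty, Finset.card_empty, Nat.cast_zero] at this
      have : 0 ≤ ε * Fintype.card α := by positivity
      linarith
    have := hmax (insert A P) (by
      rw [Finset.mem_filter, Finset.mem_powerset]
      refine ⟨Finset.insert_subset hA hP.1, ?_⟩
      intro B hB C hC hBC
      rw [Finset.mem_insert] at hB hC
      rcases hB with rfl | hB <;> rcases hC with rfl | hC
      · exact absurd rfl hBC
      · exact hcon _ hC
      · rw [symmDiff_comm]; exact hcon _ hB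
      · exact hP.2 _ hB _ hC hBC)
    rw [Finset.card_insert_of_notMem hAP] at this
    omega

end Packing

/-! ### Chaining for the Rademacher process of a VC class. -/

section Chaining

open Finset

variable {ι : Type*} [DecidableEq ι]

/-- The coordinate difference of the indicator of `A` between the two copies of the index `i`. -/
def pairDiff (A : Finset (ι ⊕ ι)) (i : ι) : ℝ :=
  (if Sum.inl i ∈ A then 1 else 0) - (if Sum.inr i ∈ A then 1 else 0)

theorem sq_pairDiff_sub_le (A B : Finset (ι ⊕ ι)) (i : ι) :
    (pairDiff A i - pairDiff B i) ^ 2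
      ≤ 2 * ((if Sum.inl i ∈ symmDiff A B then 1 else 0)
        + (if Sum.inr i ∈ symmDiff A B then 1 else 0)) := by
  unfold pairDiff
  simp only [Finset.mem_symmDiff]
  by_cases h1 : Sum.inl i ∈ A <;> by_cases h2 : Sum.inr i ∈ A <;>
    by_cases h3 : Sum.inl i ∈ B <;> by_cases h4 : Sum.inr i ∈ B <;>
    simp [h1, h2, h3, h4] <;> norm_num

variable [Fintype ι]

/-- The signed sum of the coordinate differences of `A`. -/
def signedSum (σ : ι → Bool) (A : Finset (ι ⊕ ι)) : ℝ := ∑ i, boolSign (σ i) * pairDiff A i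

/-- Bounds the variance of an increment of `signedSum` by the size of a symmetric difference, the
distance in which the nets are built. -/
theorem sum_sq_pairDiff_sub_le (A B : Finset (ι ⊕ ι)) :
    ∑ i, (pairDiff A i - pairDiff B i) ^ 2 ≤ 2 * #(symmDiff A B) := by
  refine (Finset.sum_le_sum fun i _ => sq_pairDiff_sub_le A B i).trans_eq ?_
  rw [← Finset.mul_sum, Finset.sum_add_distrib,
    ← Fintype.sum_sum_type (fun x => if x ∈ symmDiff A B then (1 : ℝ) else 0)]
  simp

theorem signedSum_sub (σ : ι → Bool) (A B : Finset (ι ⊕ ι)) :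
    signedSum σ A - signedSum σ B = ∑ i, boolSign (σ i) * (pairDiff A i - pairDiff B i) := by
  simp only [signedSum, ← Finset.sum_sub_distrib, mul_sub]

open Classical in
/-- The chaining bound for the Rademacher process indexed by a set family of small VC dimension. -/
theorem card_exists_lt_abs_signedSum_le [Nonempty ι] (𝒜 : Finset (Finset (ι ⊕ ι))) {d : ℕ}
    (hd : 𝒜.vcDim ≤ d) (hd1 : 1 ≤ d) {S l : ℝ} (hS : 0 ≤ S) (hl : 1 ≤ l)
    (hSl : 512 * Fintype.card ι * (4 * d + l) ≤ S ^ 2) :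
    (#{σ : ι → Bool | ∃ A ∈ 𝒜, S < |signedSum σ A|} : ℝ)
      ≤ 2 ^ Fintype.card ι * (2 * Real.exp (-l)) := by
  have hm : (0 : ℝ) < Fintype.card ι := by exact_mod_cast Fintype.card_pos
  set m : ℝ := ((Fintype.card ι : ℕ) : ℝ)
  have hcard2 : (Fintype.card (ι ⊕ ι) : ℝ) = 2 * m := by
    rw [Fintype.card_sum]; push_cast; ring
  choose N hN1 hN2 hN3 using fun j => exists_net 𝒜 hd hd1 j
  -- Level zero is replaced by the empty set, where the process vanishes, so the chain needs no
  -- starting estimate.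
  set P : ℕ → Finset (Finset (ι ⊕ ι)) := fun j => if j = 0 then {∅} else N j with hP
  have hPpar : ∀ j : ℕ, ∀ B : Finset (ι ⊕ ι), ∃ B', B ∈ 𝒜 →
      B' ∈ P j ∧ (#(symmDiff B B') : ℝ) ≤ (1 / 4) ^ j * (2 * m) := by
    intro j B
    by_cases hB : B ∈ 𝒜
    · rcases Nat.eq_zero_or_pos j with rfl | hj
      · refine ⟨∅, fun _ => ⟨by simp [hP], ?_⟩⟩
        rw [← hcard2, pow_zero, one_mul]
        exact_mod_cast Finset.card_le_univ _
      · obtain ⟨B', h1, h2⟩ := hN3 j B hB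
        refine ⟨B', fun _ => ⟨?_, by rwa [hcard2] at h2⟩⟩
        simpa [hP, hj.ne'] using h1
    · exact ⟨∅, fun h => absurd h hB⟩
  choose par hpar using hPpar
  -- The thresholds sum to `3 S / 4`, below `S`. The factor `j + 2` makes the tail exponent at level
  -- `j` grow like `(j + 2) ^ 2`, which beats the entropy `4 d (j + 2)` of the net.
  set thr : ℕ → ℝ := fun j => S * (j + 2) / (4 * 2 ^ (j + 1)) with hthr
  set bad : ℕ → Finset (ι ⊕ ι) → Finset (ι → Bool) := fun j B =>
    {σ : ι → Bool | thr j < |signedSum σ B - signedSum σ (par j B)|} with hbad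
  set J := Fintype.card (ι ⊕ ι) with hJ
  have hsub : ({σ : ι → Bool | ∃ A ∈ 𝒜, S < |signedSum σ A|} : Finset (ι → Bool))
      ⊆ (range J).biUnion fun j => (N (j + 1)).biUnion fun B => bad j B := by
    intro σ hσ
    by_contra hcon
    have hgood : ∀ j < J, ∀ B ∈ N (j + 1),
        |signedSum σ B - signedSum σ (par j B)| ≤ thr j := by
      intro j hj B hB
      by_contra! h
      exact hcon (Finset.mem_biUnion.2 ⟨j, Finset.mem_range.2 hj,
        Finset.mem_biUnion.2 ⟨B, hB, Finset.mem_filter.2 ⟨Finset.mem_univ _, h⟩⟩⟩)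
    -- The right-hand side is the closed form of the sum of the first `j` thresholds.
    have hind : ∀ j ≤ J, ∀ B ∈ P j, |signedSum σ B| ≤ S / 4 * (3 - (j + 3) / 2 ^ j) := by
      intro j
      induction j with
      | zero =>
        intro _ B hB
        have : B = ∅ := by simpa [hP] using hB
        subst this
        simp [signedSum, pairDiff]
      | succ j ih =>
        intro hj B hB
        have hB' : B ∈ N (j + 1) := by simpa [hP] using hB
        have h1 := hgood j (by omega) B hB'
        have h2 := ih (by omega) _ (hpar j B (hN1 _ hB')).1
        have h3 : |signedSum σ B| ≤ |signedSum σ B - signedSum σ (par j B)|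
            + |signedSum σ (par j B)| := by
          have := abs_add_le (signedSum σ B - signedSum σ (par j B)) (signedSum σ (par j B))
          simpa using this
        have h4 : S / 4 * (3 - ((j : ℝ) + 3) / 2 ^ j) + thr j
            = S / 4 * (3 - (((j + 1 : ℕ) : ℝ) + 3) / 2 ^ (j + 1)) := by
          rw [hthr]; push_cast; rw [pow_succ]; field_simp; ring
        linarith
    obtain ⟨A, hA, hSA⟩ := (Finset.mem_filter.1 hσ).2
    have hJ0 : J ≠ 0 := Fintype.card_ne_zero
    obtain ⟨B, hB, hAB⟩ := hN3 J A hA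
    -- At level `J` the radius is below one point, so the chain reaches `A` itself.
    have hlt : (1 / 4 : ℝ) ^ J * J < 1 := by
      have h1 : (J : ℝ) < 4 ^ J := by exact_mod_cast Nat.lt_pow_self (by norm_num)
      rw [one_div, inv_pow, inv_mul_lt_iff₀ (by positivity)]
      linarith
    have h0 : #(symmDiff A B) < 1 := by
      have : (#(symmDiff A B) : ℝ) < 1 := hAB.trans_lt hlt
      exact_mod_cast this
    have hAB' : A = B := by
      rw [Nat.lt_one_iff, Finset.card_eq_zero] at h0
      exact symmDiff_eq_bot.1 h0
    have h5 := hind J le_rfl A (by simpa [hP, hJ0, hAB'] using hB)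
    have h6 : (0 : ℝ) ≤ (J + 3) / 2 ^ J := by positivity
    nlinarith
  have hbc : ∀ j, ∀ B ∈ N (j + 1), (#(bad j B) : ℝ)
      ≤ 2 ^ Fintype.card ι * (2 * Real.exp (-((4 * d + l) * (j + 2) ^ 2))) := by
    intro j B hB
    obtain ⟨-, h2⟩ := hpar j B (hN1 _ hB)
    have h3 := sum_sq_pairDiff_sub_le B (par j B)
    have hV : (0 : ℝ) < 4 * m * (1 / 4) ^ j := by positivity
    have h4 := card_lt_abs_sum_boolSign_le
      (fun i => pairDiff B i - pairDiff (par j B) i) (s := thr j) hV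
      (h3.trans (by linarith)) (by positivity)
    simp only [hbad, signedSum_sub]
    refine h4.trans ?_
    gcongr
    have h5 : thr j ^ 2 / (2 * (4 * m * (1 / 4) ^ j)) = S ^ 2 / (512 * m) * (j + 2) ^ 2 := by
      rw [hthr]
      have h6 : ((2 : ℝ) ^ (j + 1)) ^ 2 = 4 * 4 ^ j := by
        rw [← pow_mul, mul_comm, pow_mul, pow_succ]; norm_num; ring
      simp only [div_pow, mul_pow, h6, one_div, inv_pow]
      field_simp
      ring
    rw [h5]
    gcongr
    rw [le_div_iff₀ (by positivity)]
    linarith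
  have hlev : ∀ j, (#((N (j + 1)).biUnion fun B => bad j B) : ℝ)
      ≤ 2 ^ Fintype.card ι * (2 * Real.exp (-l)) * (1 / 2) ^ (j + 1) := by
    intro j
    calc (#((N (j + 1)).biUnion fun B => bad j B) : ℝ)
        ≤ ∑ B ∈ N (j + 1), (#(bad j B) : ℝ) := by exact_mod_cast Finset.card_biUnion_le
      _ ≤ #(N (j + 1)) * (2 ^ Fintype.card ι
            * (2 * Real.exp (-((4 * d + l) * (j + 2) ^ 2)))) := by
          rw [← nsmul_eq_mul]
          exact Finset.sum_le_card_nsmul _ _ _ (hbc j)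
      _ ≤ Real.exp (4 * d * ((j + 1 : ℕ) + 1)) * (2 ^ Fintype.card ι
            * (2 * Real.exp (-((4 * d + l) * (j + 2) ^ 2)))) := by
          gcongr
          exact hN2 (j + 1)
      _ = 2 ^ Fintype.card ι * 2 * Real.exp (4 * d * ((j + 1 : ℕ) + 1)
            + -((4 * d + l) * (j + 2) ^ 2)) := by
          rw [Real.exp_add]; ring
      _ ≤ 2 ^ Fintype.card ι * 2 * (Real.exp (-l) * (1 / 2) ^ (j + 1)) := by
          gcongr
          have h1 : (1 / 2 : ℝ) ^ (j + 1) = Real.exp (-((j + 1 : ℕ) * Real.log 2)) := by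
            rw [Real.exp_neg, Real.exp_nat_mul, Real.exp_log (by norm_num), one_div, inv_pow]
          rw [h1, ← Real.exp_add, Real.exp_le_exp]
          have h2 : Real.log 2 ≤ 1 := by
            have := Real.log_two_lt_d9; linarith
          have hj : (0 : ℝ) ≤ j := by positivity
          have hd0 : (0 : ℝ) ≤ d := by positivity
          push_cast
          -- After the entropy is paid, `l (j + 2)` remains, and `l ≥ 1` makes this at least `l + (j
          -- + 1)`: the spare `j + 1` gives the geometric factor over the levels.
          have h3 : (4 * (d : ℝ) + l) * (j + 2) ≤ (4 * d + l) * (j + 2) ^ 2 := by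
            gcongr
            nlinarith
          nlinarith
      _ = _ := by ring
  calc (#{σ : ι → Bool | ∃ A ∈ 𝒜, S < |signedSum σ A|} : ℝ)
      ≤ #((range J).biUnion fun j => (N (j + 1)).biUnion fun B => bad j B) := by
        exact_mod_cast Finset.card_le_card hsub
    _ ≤ ∑ j ∈ range J, (#((N (j + 1)).biUnion fun B => bad j B) : ℝ) := by
        exact_mod_cast Finset.card_biUnion_le
    _ ≤ ∑ j ∈ range J, 2 ^ Fintype.card ι * (2 * Real.exp (-l)) * (1 / 2) ^ (j + 1) :=
        Finset.sum_le_sum fun j _ => hlev j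
    _ = 2 ^ Fintype.card ι * (2 * Real.exp (-l)) * ((1 / 2) * ∑ j ∈ range J, (1 / 2) ^ j) := by
        rw [← Finset.mul_sum, Finset.mul_sum (range J) _ (1 / 2 : ℝ)]
        simp only [pow_succ']
    _ ≤ 2 ^ Fintype.card ι * (2 * Real.exp (-l)) * 1 := by
        gcongr
        have := sum_geometric_two_le J
        linarith
    _ = _ := by ring

end Chaining

/-! ### Second moments for sampling without repetition. -/

section Embeddings

open Finset

variable {α : Type*} [Fintype α] [DecidableEq α]

/-- Under a uniformly random permutation, the values of a centred function at two distinct points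
are nonpositively correlated. -/
theorem sum_perm_mul_le_zero {g : α → ℝ} (hg : ∑ x, g x = 0) {x y : α} (hxy : x ≠ y) :
    ∑ τ : Equiv.Perm α, g (τ x) * g (τ y) ≤ 0 := by
  -- By symmetry all off-diagonal correlations with `x` agree. Together with the nonnegative
  -- diagonal term they sum to zero, as `g` is centred, so each is nonpositive.
  have hconst : ∀ y' ∈ univ.erase x, ∑ τ : Equiv.Perm α, g (τ x) * g (τ y')
      = ∑ τ : Equiv.Perm α, g (τ x) * g (τ y) := by
    intro y' hy'
    refine Fintype.sum_equiv (Equiv.mulRight (Equiv.swap y y')) _ _ fun τ => ?_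
    have : Equiv.swap y y' x = x :=
      Equiv.swap_apply_of_ne_of_ne hxy (Finset.ne_of_mem_erase hy').symm
    simp [this]
  have htot : ∑ y', ∑ τ : Equiv.Perm α, g (τ x) * g (τ y') = 0 := by
    rw [Finset.sum_comm]
    refine Finset.sum_eq_zero fun τ _ => ?_
    rw [← Finset.mul_sum, Equiv.sum_comp τ g, hg, mul_zero]
  rw [← Finset.add_sum_erase _ _ (Finset.mem_univ x), Finset.sum_congr rfl hconst,
    Finset.sum_const, nsmul_eq_mul] at htot
  have h1 : 0 ≤ ∑ τ : Equiv.Perm α, g (τ x) * g (τ x) :=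
    Finset.sum_nonneg fun τ _ => mul_self_nonneg _
  have h2 : (0 : ℝ) < #(univ.erase x) := by
    exact_mod_cast Finset.card_pos.2 ⟨y, Finset.mem_erase.2 ⟨hxy.symm, Finset.mem_univ _⟩⟩
  by_contra! h
  have := mul_pos h2 h
  linarith

/-- Relabelling the values by a permutation permutes the embeddings, so one may average over all
permutations and apply `sum_perm_mul_le_zero` to the distinct points `h i` and `h j`. -/
theorem sum_embedding_mul_le_zero {ι : Type*} [Fintype ι] [DecidableEq ι] {g : α → ℝ}
    (hg : ∑ x, g x = 0) {i j : ι} (hij : i ≠ j) :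
    ∑ h : ι ↪ α, g (h i) * g (h j) ≤ 0 := by
  have hinv : ∀ τ : Equiv.Perm α, ∑ h : ι ↪ α, g (τ (h i)) * g (τ (h j))
      = ∑ h : ι ↪ α, g (h i) * g (h j) := fun τ =>
    Fintype.sum_equiv (Equiv.embeddingCongr (Equiv.refl ι) τ) _ _ fun h => by simp
  have h1 : ∑ τ : Equiv.Perm α, ∑ h : ι ↪ α, g (τ (h i)) * g (τ (h j)) ≤ 0 := by
    rw [Finset.sum_comm]
    exact Finset.sum_nonpos fun h _ => sum_perm_mul_le_zero hg (h.injective.ne hij)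
  rw [Finset.sum_congr rfl fun τ _ => hinv τ, Finset.sum_const, nsmul_eq_mul] at h1
  have h2 : (0 : ℝ) < #(univ : Finset (Equiv.Perm α)) := by
    exact_mod_cast Finset.card_pos.2 Finset.univ_nonempty
  by_contra! h
  have := mul_pos h2 h
  linarith

/-- The second moment of a sum over a sample without repetition of a centred function. -/
theorem sum_embedding_sq_le {ι : Type*} [Fintype ι] [DecidableEq ι] {g : α → ℝ}
    (hg : ∑ x, g x = 0) (hg1 : ∀ x, g x ^ 2 ≤ 1) :
    ∑ h : ι ↪ α, (∑ i, g (h i)) ^ 2 ≤ Fintype.card ι * Fintype.card (ι ↪ α) := by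
  have h1 : ∀ h : ι ↪ α, (∑ i, g (h i)) ^ 2
      = ∑ i, (g (h i) ^ 2 + ∑ j ∈ univ.erase i, g (h i) * g (h j)) := by
    intro h
    rw [sq, Finset.sum_mul_sum]
    refine Finset.sum_congr rfl fun i _ => ?_
    rw [← Finset.add_sum_erase _ _ (Finset.mem_univ i), sq]
  simp only [h1]
  rw [Finset.sum_comm]
  have h2 : ∀ i : ι, ∑ h : ι ↪ α, (g (h i) ^ 2 + ∑ j ∈ univ.erase i, g (h i) * g (h j))
      ≤ Fintype.card (ι ↪ α) := by
    intro i
    rw [Finset.sum_add_distrib, Finset.sum_comm]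
    have h3 : ∑ h : ι ↪ α, g (h i) ^ 2 ≤ Fintype.card (ι ↪ α) := by
      refine (Finset.sum_le_sum fun h _ => hg1 (h i)).trans_eq ?_
      simp
    have h4 : ∑ j ∈ univ.erase i, ∑ h : ι ↪ α, g (h i) * g (h j) ≤ 0 :=
      Finset.sum_nonpos fun j hj => sum_embedding_mul_le_zero hg (Finset.ne_of_mem_erase hj).symm
    linarith
  refine (Finset.sum_le_sum fun i _ => h2 i).trans_eq ?_
  simp

/-- A random sample without repetition is, with probability at least `1/2`, representative for a
given set. -/
theorem card_embedding_le_two_mul_card {ι : Type*} [Fintype ι] [DecidableEq ι]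
    (A : Finset α) {s : ℝ} (hs : 0 < s) (hs2 : 2 * Fintype.card ι ≤ s ^ 2) :
    (Fintype.card (ι ↪ α) : ℝ) ≤ 2 * #{h : ι ↪ α |
      |(#{i | h i ∈ A} : ℝ) - Fintype.card ι * #A / Fintype.card α| ≤ s} := by
  rcases isEmpty_or_nonempty (ι ↪ α) with he | ⟨⟨h0⟩⟩
  · simp
  rcases isEmpty_or_nonempty α with hα | hα
  · have : IsEmpty ι := ⟨fun i => hα.false (h0 i)⟩
    have : ∀ h : ι ↪ α,
        |(#{i | h i ∈ A} : ℝ) - Fintype.card ι * #A / Fintype.card α| ≤ s := by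
      intro h; simp [hs.le]
    simp only [this, Finset.filter_true, Finset.card_univ]
    have : (0 : ℝ) ≤ Fintype.card (ι ↪ α) := by positivity
    linarith
  have hN : (0 : ℝ) < Fintype.card α := by exact_mod_cast Fintype.card_pos
  set g : α → ℝ := fun x => (if x ∈ A then 1 else 0) - #A / Fintype.card α with hgdef
  have hg : ∑ x, g x = 0 := by
    simp only [hgdef, Finset.sum_sub_distrib, Finset.sum_boole, Finset.sum_const, nsmul_eq_mul,
      Finset.card_univ]
    rw [mul_div_cancel₀ _ hN.ne']
    simp
  have hg1 : ∀ x, g x ^ 2 ≤ 1 := by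
    intro x
    have h1 : (#A : ℝ) / Fintype.card α ≤ 1 := by
      rw [div_le_one hN]; exact_mod_cast Finset.card_le_univ A
    have h2 : (0 : ℝ) ≤ #A / Fintype.card α := by positivity
    simp only [hgdef]
    split_ifs <;> nlinarith
  have hsum : ∀ h : ι ↪ α, ∑ i, g (h i)
      = (#{i | h i ∈ A} : ℝ) - Fintype.card ι * #A / Fintype.card α := by
    intro h
    simp only [hgdef, Finset.sum_sub_distrib, Finset.sum_boole, Finset.sum_const, nsmul_eq_mul,
      Finset.card_univ, mul_div_assoc]
  have hvar := sum_embedding_sq_le (ι := ι) hg hg1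
  simp only [← hsum]
  have hsplit := Finset.card_filter_add_card_filter_not
    (s := (univ : Finset (ι ↪ α))) (fun h => |∑ i, g (h i)| ≤ s)
  have hsplit' : (#{h : ι ↪ α | |∑ i, g (h i)| ≤ s} : ℝ)
      + #{h : ι ↪ α | ¬ |∑ i, g (h i)| ≤ s} = Fintype.card (ι ↪ α) := by
    exact_mod_cast hsplit
  -- Chebyshev's inequality; with `s² ≥ 2 |ι|` at most half of the embeddings deviate.
  have hcheb : (#{h : ι ↪ α | ¬ |∑ i, g (h i)| ≤ s} : ℝ) * s ^ 2
      ≤ ∑ h : ι ↪ α, (∑ i, g (h i)) ^ 2 := by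
    rw [← nsmul_eq_mul, ← Finset.sum_const]
    refine (Finset.sum_le_sum fun h hh => ?_).trans
      (Finset.sum_le_sum_of_subset_of_nonneg (Finset.subset_univ _) fun _ _ _ => sq_nonneg _)
    have := (Finset.mem_filter.1 hh).2
    rw [not_le] at this
    rw [← sq_abs (∑ i, g (h i))]
    exact pow_le_pow_left₀ hs.le this.le 2
  have h5 : (Fintype.card ι : ℝ) * Fintype.card (ι ↪ α) ≤ s ^ 2 / 2 * Fintype.card (ι ↪ α) := by
    gcongr; linarith
  have h6 : (#{h : ι ↪ α | ¬ |∑ i, g (h i)| ≤ s} : ℝ) ≤ Fintype.card (ι ↪ α) / 2 := by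
    have h7 : 0 < s ^ 2 := by positivity
    by_contra h8
    rw [not_le] at h8
    have := mul_lt_mul_of_pos_right h8 h7
    linarith
  linarith

/-- The number of injections of `Fin m` whose range has a given property. -/
theorem card_embedding_filter_map (m : ℕ) (p : Finset α → Prop) [DecidablePred p] :
    #{h : Fin m ↪ α | p (univ.map h)} = #{C ∈ powersetCard m univ | p C} * m.factorial := by
  have hmaps : ∀ h ∈ ({h : Fin m ↪ α | p (univ.map h)} : Finset (Fin m ↪ α)),
      univ.map h ∈ ({C ∈ powersetCard m univ | p C} : Finset (Finset α)) := by
    intro h hh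
    rw [Finset.mem_filter] at hh ⊢
    exact ⟨by simp [Finset.mem_powersetCard], hh.2⟩
  rw [Finset.card_eq_sum_card_fiberwise hmaps, ← smul_eq_mul, ← Finset.sum_const]
  refine Finset.sum_congr rfl fun C hC => ?_
  obtain ⟨hC, hpC⟩ := Finset.mem_filter.1 hC
  have hCm : #C = m := (Finset.mem_powersetCard.1 hC).2
  have h1 : ({h ∈ ({h : Fin m ↪ α | p (univ.map h)} : Finset (Fin m ↪ α)) | univ.map h = C})
      = ({h : Fin m ↪ α | ∀ i, h i ∈ C} : Finset (Fin m ↪ α)) := by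
    ext h
    simp only [Finset.mem_filter, Finset.mem_univ, true_and]
    constructor
    · rintro ⟨-, rfl⟩ i
      simp
    · intro h2
      have h3 : univ.map h = C := by
        refine Finset.eq_of_subset_of_card_le ?_ (by simp [hCm])
        intro x hx
        obtain ⟨i, -, rfl⟩ := Finset.mem_map.1 hx
        exact h2 i
      exact ⟨h3 ▸ hpC, h3⟩
  rw [h1, ← Fintype.card_subtype]
  have e : {h : Fin m ↪ α // ∀ i, h i ∈ C} ≃ (Fin m ↪ C) := Equiv.codRestrict (Fin m) (C : Set α)
  rw [Fintype.card_congr e, Fintype.card_embedding_eq]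
  simp [hCm, Nat.descFactorial_self]

end Embeddings

/-! ### Symmetrization by disjoint ghost samples. -/

section Symmetrization

open Finset

variable {ι : Type*}

/-- Swap the two copies of `i` for all `i` with `σ i = true`. -/
def swapCopies (σ : ι → Bool) : Equiv.Perm (ι ⊕ ι) :=
  Function.Involutive.toPerm
    (Sum.elim (fun i => if σ i then Sum.inr i else Sum.inl i)
      (fun i => if σ i then Sum.inl i else Sum.inr i))
    (by rintro (i | i) <;> cases h : σ i <;> simp [h])

theorem swapCopies_inl (σ : ι → Bool) (i : ι) :
    swapCopies σ (Sum.inl i) = if σ i then Sum.inr i else Sum.inl i := rfl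

theorem swapCopies_inr (σ : ι → Bool) (i : ι) :
    swapCopies σ (Sum.inr i) = if σ i then Sum.inl i else Sum.inr i := rfl

variable [Fintype ι] [DecidableEq ι] {α : Type*} [DecidableEq α]

/-- The difference of the numbers of points of the two halves of a double sample in `A`. -/
def halvesDiff (e : ι ⊕ ι → α) (A : Finset α) : ℝ :=
  (#{i | e (Sum.inl i) ∈ A} : ℝ) - #{i | e (Sum.inr i) ∈ A}

theorem halvesDiff_swapCopies (σ : ι → Bool) (e : ι ⊕ ι → α) (A : Finset α) :
    halvesDiff (e ∘ swapCopies σ) A = signedSum σ {x | e x ∈ A} := by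
  unfold halvesDiff signedSum
  rw [← Finset.sum_boole, ← Finset.sum_boole, ← Finset.sum_sub_distrib]
  refine Finset.sum_congr rfl fun i _ => ?_
  simp only [Function.comp_apply, swapCopies_inl, swapCopies_inr, pairDiff, boolSign,
    Finset.mem_filter, Finset.mem_univ, true_and]
  by_cases h : σ i = true <;> simp [h]

variable [Fintype α]

open Classical in
-- Swapping copies permutes the double samples, so the count equals its average over all sign
-- patterns. For a fixed double sample the swapped differences are signed sums over the pullback of
-- `𝒮`, whose VC dimension is no larger, and chaining applies.
theorem card_exists_lt_abs_halvesDiff_le [Nonempty ι] (𝒮 : Finset (Finset α)) {d : ℕ}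
    (hd : 𝒮.vcDim ≤ d) (hd1 : 1 ≤ d) {S l : ℝ} (hS : 0 ≤ S) (hl : 1 ≤ l)
    (hSl : 512 * Fintype.card ι * (4 * d + l) ≤ S ^ 2) :
    (#{e : ι ⊕ ι ↪ α | ∃ A ∈ 𝒮, S < |halvesDiff e A|} : ℝ)
      ≤ 2 * Real.exp (-l) * Fintype.card (ι ⊕ ι ↪ α) := by
  set G : (ι ⊕ ι → α) → Prop := fun e => ∃ A ∈ 𝒮, S < |halvesDiff e A| with hG
  have hinv : ∀ σ : ι → Bool, (∑ e : ι ⊕ ι ↪ α, if G (e ∘ swapCopies σ) then (1 : ℝ) else 0)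
      = ∑ e : ι ⊕ ι ↪ α, if G e then (1 : ℝ) else 0 := by
    intro σ
    refine Fintype.sum_equiv (Equiv.embeddingCongr (swapCopies σ).symm (Equiv.refl α)) _ _
      fun e => ?_
    have : ((Equiv.embeddingCongr (swapCopies σ).symm (Equiv.refl α)) e : ι ⊕ ι → α)
        = e ∘ swapCopies σ := by
      ext x; simp
    rw [this]
  have hsigns : ∀ e : ι ⊕ ι ↪ α,
      (∑ σ : ι → Bool, if G (e ∘ swapCopies σ) then (1 : ℝ) else 0)
        ≤ 2 ^ Fintype.card ι * (2 * Real.exp (-l)) := by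
    intro e
    have h1 := card_exists_lt_abs_signedSum_le
      (𝒮.image fun A => ({x | e x ∈ A} : Finset (ι ⊕ ι)))
      ((vcDim_image_preimage_le 𝒮 e).trans hd) hd1 hS hl hSl
    rw [Finset.sum_boole]
    refine le_trans ?_ h1
    norm_cast
    refine Finset.card_le_card fun σ hσ => ?_
    obtain ⟨A, hA, h2⟩ := (Finset.mem_filter.1 hσ).2
    rw [halvesDiff_swapCopies] at h2
    exact Finset.mem_filter.2 ⟨Finset.mem_univ _, _, Finset.mem_image_of_mem _ hA, h2⟩
  have h1 : (2 : ℝ) ^ Fintype.card ι * #{e : ι ⊕ ι ↪ α | G e}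
      = ∑ e : ι ⊕ ι ↪ α, ∑ σ : ι → Bool, if G (e ∘ swapCopies σ) then (1 : ℝ) else 0 := by
    rw [Finset.sum_comm, Finset.sum_congr rfl fun σ _ => hinv σ, Finset.sum_boole,
      Finset.sum_const, nsmul_eq_mul]
    simp
  have h2 : (2 : ℝ) ^ Fintype.card ι * #{e : ι ⊕ ι ↪ α | G e}
      ≤ 2 ^ Fintype.card ι * (2 * Real.exp (-l) * Fintype.card (ι ⊕ ι ↪ α)) := by
    rw [h1]
    refine (Finset.sum_le_sum fun e _ => hsigns e).trans_eq ?_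
    rw [Finset.sum_const, nsmul_eq_mul, Finset.card_univ]
    ring
  exact le_of_mul_le_mul_left h2 (by positivity)

open Classical in
/-- Symmetrization: if `f` deviates from `α` on some member of `𝒮`, then at least half of its
disjoint ghost samples deviate from `f` by half of that. -/
theorem card_ghost_le (𝒮 : Finset (Finset α)) {S : ℝ} (hS : 0 < S)
    (hS2 : 2 * Fintype.card ι ≤ S ^ 2) (f : ι ↪ α)
    (hf : ∃ A ∈ 𝒮, 2 * S <
      |(#{i | f i ∈ A} : ℝ) - Fintype.card ι * #A / Fintype.card α|)
    (hcard : Fintype.card ι < Fintype.card α) :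
    (Fintype.card (ι ↪ ↥(Set.range f)ᶜ) : ℝ) ≤ 2 * #{h : ι ↪ ↥(Set.range f)ᶜ |
      ∃ A ∈ 𝒮, S < |(#{i | f i ∈ A} : ℝ) - #{i | (h i : α) ∈ A}|} := by
  obtain ⟨A, hA, hdev⟩ := hf
  set B : Finset ↥(Set.range f)ᶜ := {y | (y : α) ∈ A} with hB
  have hghost := card_embedding_le_two_mul_card (ι := ι) B hS hS2
  refine hghost.trans ?_
  gcongr 2 * ((#?_ : ℕ) : ℝ)
  intro h hh
  have hh := (Finset.mem_filter.1 hh).2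
  refine Finset.mem_filter.2 ⟨Finset.mem_univ _, A, hA, ?_⟩
  have hBc : (#{i | h i ∈ B} : ℝ) = #{i | (h i : α) ∈ A} := by simp [hB]
  rw [hBc] at hh
  have hN : (Fintype.card ↥(Set.range f)ᶜ : ℝ) = Fintype.card α - Fintype.card ι := by
    rw [Fintype.card_compl_set, Set.card_range_of_injective f.injective, Nat.cast_sub hcard.le]
  have hBA : (#B : ℝ) = #A - #{i | f i ∈ A} := by
    have h1 : #(B.map (Function.Embedding.subtype _)) + #(({i | f i ∈ A} : Finset ι).map f)
        = #A := by
      rw [← Finset.card_union_of_disjoint]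
      · congr 1
        ext x
        simp only [Finset.mem_union, Finset.mem_map, hB, Finset.mem_filter, Finset.mem_univ,
          true_and]
        constructor
        · rintro (⟨y, hy, rfl⟩ | ⟨i, hi, rfl⟩)
          · exact hy
          · exact hi
        · intro hx
          by_cases hr : x ∈ Set.range f
          · obtain ⟨i, rfl⟩ := hr
            exact Or.inr ⟨i, hx, rfl⟩
          · exact Or.inl ⟨⟨x, hr⟩, hx, rfl⟩
      · rw [Finset.disjoint_left]
        intro x hx hx'
        obtain ⟨y, -, rfl⟩ := Finset.mem_map.1 hx
        obtain ⟨i, -, hi⟩ := Finset.mem_map.1 hx'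
        exact y.2 ⟨i, hi⟩
    rw [Finset.card_map, Finset.card_map] at h1
    rw [eq_sub_iff_add_eq]
    exact_mod_cast h1
  rw [hN, hBA] at hh
  set c : ℝ := ((#{i | f i ∈ A} : ℕ) : ℝ)
  set c' : ℝ := ((#{i | (h i : α) ∈ A} : ℕ) : ℝ)
  set n : ℝ := ((Fintype.card α : ℕ) : ℝ)
  set m : ℝ := ((Fintype.card ι : ℕ) : ℝ)
  have hmn : 0 < n - m := by
    rw [sub_pos]; exact Nat.cast_lt.2 hcard
  have hm0 : 0 ≤ m := Nat.cast_nonneg _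
  have hn : 0 < n := by linarith
  -- The ghost sample comes from the complement of the range of `f`, so its mean count is `m (|A| -
  -- c) / (n - m)`. The deviation of `c` from this mean is the original one times `n / (n - m) ≥ 1`.
  have h1 : c - m * (#A - c) / (n - m) = n / (n - m) * (c - m * #A / n) := by
    field_simp
    ring
  have h2 : 2 * S < |c - m * (#A - c) / (n - m)| := by
    rw [h1, abs_mul, abs_of_pos (by positivity)]
    have h3 : 1 ≤ n / (n - m) := by rw [le_div_iff₀ hmn]; linarith
    have h4 := abs_nonneg (c - m * #A / n)
    nlinarith
  have h3 := abs_sub_abs_le_abs_sub (c - m * (#A - c) / (n - m)) (c' - m * (#A - c) / (n - m))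
  have h4 : c - m * (#A - c) / (n - m) - (c' - m * (#A - c) / (n - m)) = c - c' := by ring
  rw [h4] at h3
  linarith

open Classical in
/-- A uniform sample of at most half of the points is representative for all members of a family
of small VC dimension. -/
theorem card_deviating_le_of_two_mul_le (𝒮 : Finset (Finset α)) {d m : ℕ} (hd : 𝒮.vcDim ≤ d)
    (hd1 : 1 ≤ d) (hm : 1 ≤ m) (hm2 : 2 * m ≤ Fintype.card α) {t l : ℝ} (ht : 0 ≤ t)
    (hl : 1 ≤ l) (htl : 2048 * m * (4 * d + l) ≤ t ^ 2) :
    (#{C ∈ powersetCard m univ | ∃ A ∈ 𝒮, t < |(#(C ∩ A) : ℝ) - m * #A / Fintype.card α|} : ℝ)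
      ≤ 4 * Real.exp (-l) * #(powersetCard m (univ : Finset α)) := by
  have : Nonempty (Fin m) := ⟨⟨0, hm⟩⟩
  have hm0 : (1 : ℝ) ≤ m := by exact_mod_cast hm
  have hdl : (1 : ℝ) ≤ 4 * d + l := by
    have : (0 : ℝ) ≤ d := by positivity
    linarith
  have hmdl : (m : ℝ) ≤ m * (4 * d + l) := le_mul_of_one_le_right (by positivity) hdl
  have ht0 : 0 < t := by
    rcases ht.eq_or_lt with h | h
    · rw [← h] at htl; nlinarith
    · exact h
  have hcardι : Fintype.card (Fin m) = m := Fintype.card_fin m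
  set p : Finset α → Prop := fun C =>
    ∃ A ∈ 𝒮, t < |(#(C ∩ A) : ℝ) - m * #A / Fintype.card α| with hp
  set D : ℕ := (Fintype.card α - m).descFactorial m with hD
  have hDf : ∀ f : Fin m ↪ α, Fintype.card (Fin m ↪ ↥(Set.range f)ᶜ) = D := by
    intro f
    rw [Fintype.card_embedding_eq, Fintype.card_compl_set,
      Set.card_range_of_injective f.injective, hcardι]
  -- Disjoint ghost samples exist because `2 m ≤ n`.
  have hDpos : (0 : ℝ) < D := by
    exact_mod_cast Nat.pos_of_ne_zero fun h => by
      rw [hD, Nat.descFactorial_eq_zero_iff_lt] at h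
      omega
  have hcount : ∀ f : Fin m ↪ α, ∀ A : Finset α, #((univ.map f) ∩ A) = #{i | f i ∈ A} := by
    intro f A
    rw [← Finset.card_map f]
    congr 1
    ext x
    simp only [Finset.mem_inter, Finset.mem_map, Finset.mem_filter, Finset.mem_univ, true_and]
    constructor
    · rintro ⟨⟨i, rfl⟩, h⟩
      exact ⟨i, h, rfl⟩
    · rintro ⟨i, h, rfl⟩
      exact ⟨⟨i, rfl⟩, h⟩
  have hE : Fintype.card (Fin m ⊕ Fin m ↪ α) = #(powersetCard m (univ : Finset α))
      * m.factorial * D := by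
    have h1 := card_embedding_filter_map (α := α) m (fun _ => True)
    simp only [Finset.filter_true, Finset.card_univ] at h1
    rw [← h1, Fintype.card_congr Equiv.sumEmbeddingEquivSigmaEmbeddingRestricted,
      Fintype.card_sigma, Finset.sum_congr rfl fun f _ => hDf f, Finset.sum_const, smul_eq_mul,
      Finset.card_univ]
  -- Passing to ghosts halves the deviation, which turns the chaining constant `512` into `2048`.
  have hG := card_exists_lt_abs_halvesDiff_le (ι := Fin m) 𝒮 hd hd1 (S := t / 2) (l := l)
    (by positivity) hl (by rw [hcardι]; nlinarith)
  have hGsum : #{e : Fin m ⊕ Fin m ↪ α | ∃ A ∈ 𝒮, t / 2 < |halvesDiff e A|}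
      = ∑ f : Fin m ↪ α, #{h : Fin m ↪ ↥(Set.range f)ᶜ |
        ∃ A ∈ 𝒮, t / 2 < |(#{i | f i ∈ A} : ℝ) - #{i | (h i : α) ∈ A}|} := by
    rw [← Finset.card_sigma]
    refine Finset.card_equiv Equiv.sumEmbeddingEquivSigmaEmbeddingRestricted fun e => ?_
    simp only [Finset.mem_filter, Finset.mem_univ, true_and, Finset.mem_sigma]
    rfl
  have hghost : ((#{f : Fin m ↪ α | p (univ.map f)} : ℕ) : ℝ) * D
      ≤ 2 * #{e : Fin m ⊕ Fin m ↪ α | ∃ A ∈ 𝒮, t / 2 < |halvesDiff e A|} := by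
    rw [hGsum, Nat.cast_sum, Finset.mul_sum, ← nsmul_eq_mul, ← Finset.sum_const]
    refine (Finset.sum_le_sum fun f hf => ?_).trans
      (Finset.sum_le_sum_of_subset_of_nonneg (Finset.subset_univ _) fun _ _ _ => by positivity)
    obtain ⟨A, hA, h1⟩ := (Finset.mem_filter.1 hf).2
    rw [hcount] at h1
    rw [← hDf f]
    refine card_ghost_le 𝒮 (by positivity) ?_ f ⟨A, hA, ?_⟩ ?_
    · rw [hcardι]; nlinarith
    · rw [hcardι]; linarith
    · rw [hcardι]; omega
  rw [card_embedding_filter_map m p] at hghost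
  rw [hE] at hG
  push_cast at hghost hG
  have hfac : (0 : ℝ) < m.factorial := by exact_mod_cast m.factorial_pos
  have hfin : (#{C ∈ powersetCard m univ | p C} : ℝ) * (m.factorial * D)
      ≤ 4 * Real.exp (-l) * #(powersetCard m (univ : Finset α)) * (m.factorial * D) := by
    linarith
  exact le_of_mul_le_mul_right hfin (by positivity)

end Symmetrization

/-! ### Duality for the trimmed objective, and the coreset inequalities. -/

section TrimmedCost

open Finset

variable {Θ 𝒳 : Type*} {f : Θ → 𝒳 → ℝ} {w : 𝒳 → ℝ} {Y : Finset 𝒳} {t : ℝ} {θ : Θ}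

/-- Weak duality for the removal of outliers. -/
theorem le_weightedCost_of_isOutlierRemoval {u : 𝒳 → ℝ} (hu : IsOutlierRemoval w Y t u) {τ : ℝ}
    (hτ : 0 ≤ τ) :
    ∑ x ∈ Y, w x * min (f θ x) τ - t * τ ≤ weightedCost f (fun x => w x - u x) θ Y := by
  unfold weightedCost
  have h1 : ∑ x ∈ Y, (w x - u x) * min (f θ x) τ ≤ ∑ x ∈ Y, (w x - u x) * f θ x :=
    Finset.sum_le_sum fun x hx =>
      mul_le_mul_of_nonneg_left (min_le_left _ _) (sub_nonneg.2 (hu.1 x hx).2)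
  have h2 : ∑ x ∈ Y, u x * min (f θ x) τ ≤ ∑ x ∈ Y, u x * τ :=
    Finset.sum_le_sum fun x hx => mul_le_mul_of_nonneg_left (min_le_right _ _) (hu.1 x hx).1
  have h3 : (∑ x ∈ Y, u x) * τ ≤ t * τ :=
    mul_le_mul_of_nonneg_right (hu.2.trans_le (min_le_left _ _)) hτ
  rw [← Finset.sum_mul] at h2
  simp only [sub_mul, Finset.sum_sub_distrib] at h1 ⊢
  linarith

/-- Strong duality for the removal of outliers: the optimal multiplier is a quantile of the
costs. -/
theorem exists_isOutlierRemoval_eq (hf : ∀ x ∈ Y, 0 ≤ f θ x) (hw : ∀ x ∈ Y, 0 ≤ w x)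
    (ht : 0 ≤ t) :
    ∃ u, IsOutlierRemoval w Y t u ∧ ∃ τ, 0 ≤ τ ∧
      weightedCost f (fun x => w x - u x) θ Y = ∑ x ∈ Y, w x * min (f θ x) τ - t * τ := by
  classical
  rcases le_or_gt (∑ x ∈ Y, w x) t with htW | htW
  · refine ⟨w, ⟨fun x hx => ⟨hw x hx, le_rfl⟩, (min_eq_right htW).symm⟩, 0, le_rfl, ?_⟩
    unfold weightedCost
    rw [mul_zero, sub_zero]
    refine Finset.sum_congr rfl fun x hx => ?_
    rw [min_eq_right (hf x hx)]
    simp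
  have hY : Y.Nonempty := by
    rw [Finset.nonempty_iff_ne_empty]
    rintro rfl
    simp only [Finset.sum_empty] at htW
    linarith
  obtain ⟨x0, hx0, hx0min⟩ := Finset.exists_min_image Y (f θ) hY
  -- `y` is a most expensive item such that the items costing at least as much weigh `t` or more;
  -- its cost is the quantile `τ`.
  obtain ⟨y, hy, hymax⟩ := Finset.exists_max_image
    (Y.filter fun y => t ≤ ∑ x ∈ Y with f θ y ≤ f θ x, w x) (f θ) ⟨x0, by
      rw [Finset.mem_filter, Finset.filter_true_of_mem hx0min]
      exact ⟨hx0, htW.le⟩⟩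
  obtain ⟨hyY, hyt⟩ := Finset.mem_filter.1 hy
  set τ := f θ y with hτ
  set a := ∑ x ∈ Y with τ < f θ x, w x with ha
  set b := ∑ x ∈ Y with f θ x = τ, w x with hb
  have hat : a ≤ t := by
    rcases (Y.filter fun x => τ < f θ x).eq_empty_or_nonempty with he | hne
    · rw [ha, he]; simpa using ht
    · obtain ⟨y', hy', hmin⟩ := Finset.exists_min_image _ (f θ) hne
      obtain ⟨hy'Y, hy'τ⟩ := Finset.mem_filter.1 hy'
      by_contra! hcon
      have h1 : (Y.filter fun x => τ < f θ x) = Y.filter fun x => f θ y' ≤ f θ x := by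
        refine Finset.filter_congr fun x hx => ⟨fun h => hmin x (Finset.mem_filter.2 ⟨hx, h⟩),
          fun h => hy'τ.trans_le h⟩
      rw [ha, h1] at hcon
      exact absurd (hymax y' (Finset.mem_filter.2 ⟨hy'Y, hcon.le⟩)) (not_le.2 hy'τ)
  have hab : ∑ x ∈ Y with τ ≤ f θ x, w x = a + b := by
    rw [ha, hb, Finset.sum_filter, Finset.sum_filter, Finset.sum_filter,
      ← Finset.sum_add_distrib]
    refine Finset.sum_congr rfl fun x _ => ?_
    rcases lt_trichotomy τ (f θ x) with h | h | h
    · simp [h, h.le, h.ne']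
    · simp [h]
    · simp [h.not_ge, h.not_gt, h.ne]
  rw [hab] at hyt
  have hb0 : 0 ≤ b := Finset.sum_nonneg fun x hx => hw x (Finset.mem_filter.1 hx).1
  -- The fraction of the items of cost exactly `τ` that is removed. If `b = 0`, then `t = a` and the
  -- value `0` of the division is the right one.
  set μ := (t - a) / b with hμ
  have hμ0 : 0 ≤ μ := div_nonneg (by linarith) hb0
  have hμ1 : μ ≤ 1 := div_le_one_of_le₀ (by linarith) hb0
  have hμb : μ * b = t - a := by
    rcases hb0.eq_or_lt with h | h
    · rw [← h]; rw [← h] at hyt; linarith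
    · exact div_mul_cancel₀ _ h.ne'
  set u : 𝒳 → ℝ := fun x => if τ < f θ x then w x else if f θ x = τ then μ * w x else 0 with hu
  have hut : ∑ x ∈ Y, u x = t := by
    have h1 : ∑ x ∈ Y, u x = a + μ * b := by
      rw [ha, hb, Finset.mul_sum, Finset.sum_filter, Finset.sum_filter,
        ← Finset.sum_add_distrib]
      refine Finset.sum_congr rfl fun x _ => ?_
      simp only [hu]
      rcases lt_trichotomy τ (f θ x) with h | h | h
      · simp [h, h.ne']
      · simp [h]
      · simp [h.not_gt, h.ne]
    rw [h1, hμb]; ring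
  refine ⟨u, ⟨fun x hx => ?_, by rw [hut, min_eq_left htW.le]⟩, τ, hf y hyY, ?_⟩
  · have := hw x hx
    simp only [hu]
    split_ifs
    · exact ⟨this, le_rfl⟩
    · exact ⟨mul_nonneg hμ0 this, mul_le_of_le_one_left this hμ1⟩
    · exact ⟨le_rfl, this⟩
  · unfold weightedCost
    rw [← hut, Finset.sum_mul, ← Finset.sum_sub_distrib]
    refine Finset.sum_congr rfl fun x _ => ?_
    simp only [hu]
    rcases lt_trichotomy τ (f θ x) with h | h | h
    · simp [h, min_eq_right h.le]
    · simp [← h]; ring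
    · simp [h.not_gt, h.ne, min_eq_left h.le]

/-- Weak duality, passed to the infimum; strong duality supplies the feasible removal that makes the
infimum meaningful. -/
theorem le_trimmedCost (hf : ∀ x ∈ Y, 0 ≤ f θ x) (hw : ∀ x ∈ Y, 0 ≤ w x) (ht : 0 ≤ t) {τ : ℝ}
    (hτ : 0 ≤ τ) : ∑ x ∈ Y, w x * min (f θ x) τ - t * τ ≤ trimmedCost f w t θ Y := by
  obtain ⟨u, hu, -⟩ := exists_isOutlierRemoval_eq hf hw ht
  refine le_csInf ⟨_, u, hu, rfl⟩ ?_
  rintro v ⟨u, hu, rfl⟩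
  exact le_weightedCost_of_isOutlierRemoval hu hτ

/-- Strong duality; the dual value at `τ = 0` bounds the set below, so the infimum is at most the
value of the optimal removal. -/
theorem exists_trimmedCost_le (hf : ∀ x ∈ Y, 0 ≤ f θ x) (hw : ∀ x ∈ Y, 0 ≤ w x) (ht : 0 ≤ t) :
    ∃ τ, 0 ≤ τ ∧ trimmedCost f w t θ Y ≤ ∑ x ∈ Y, w x * min (f θ x) τ - t * τ := by
  obtain ⟨u, hu, τ, hτ, h⟩ := exists_isOutlierRemoval_eq hf hw ht
  refine ⟨τ, hτ, ?_⟩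
  rw [← h]
  refine csInf_le ⟨∑ x ∈ Y, w x * min (f θ x) 0 - t * 0, ?_⟩ ⟨u, hu, rfl⟩
  rintro v ⟨u', hu', rfl⟩
  exact le_weightedCost_of_isOutlierRemoval hu' le_rfl

/-- The layer-cake formula for one item: it turns a truncated cost into an integral of range
indicators. -/
theorem intervalIntegral_ite_le {a τ : ℝ} (ha : 0 ≤ a) (hτ : 0 ≤ τ) :
    ∫ r in (0 : ℝ)..τ, (if a ≤ r then (1 : ℝ) else 0) = τ - min a τ := by
  have h1 : (fun r : ℝ => if a ≤ r then (1 : ℝ) else 0) = (Set.Ici a).indicator fun _ => 1 := by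
    ext r; simp [Set.indicator]
  have h2 : (Set.Ioc 0 τ ∩ Set.Ici a : Set ℝ) =ᵐ[MeasureTheory.volume]
      (Set.Ioc 0 τ ∩ Set.Ioi a : Set ℝ) :=
    Filter.EventuallyEq.rfl.inter MeasureTheory.Ioi_ae_eq_Ici.symm
  rw [intervalIntegral.integral_of_le hτ, h1, MeasureTheory.setIntegral_indicator
    measurableSet_Ici, MeasureTheory.setIntegral_congr_set h2, Set.Ioc_inter_Ioi]
  rcases le_total a τ with h | h
  · simp [ha, h]
  · simp [ha, h]

theorem intervalIntegrable_ite_le (a τ : ℝ) :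
    IntervalIntegrable (fun r : ℝ => if a ≤ r then (1 : ℝ) else 0) MeasureTheory.volume 0 τ := by
  refine Monotone.intervalIntegrable fun r s hrs => ?_
  split_ifs with h1 h2
  · exact le_rfl
  · exact absurd (h1.trans hrs) h2
  · exact zero_le_one
  · exact le_rfl

/-- A `δ`-sample approximates the truncated costs. -/
theorem IsDeltaSample.abs_sum_min_sub_le (hf : ∀ x, 0 ≤ f θ x) {δ τ : ℝ} (hτ : 0 ≤ τ)
    {C X : Finset 𝒳} (hC : IsDeltaSample (inducedRanges f) δ C X) :
    |∑ x ∈ X, 1 * min (f θ x) τ - ∑ x ∈ C, (X.card : ℝ) / C.card * min (f θ x) τ|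
      ≤ δ * X.card * τ := by
  classical
  obtain ⟨hCX, hCne, hdev⟩ := hC
  have hc : (0 : ℝ) < #C := by exact_mod_cast hCne.card_pos
  have hn : (0 : ℝ) < #X := by exact_mod_cast (hCne.mono hCX).card_pos
  have hmin : ∀ x, min (f θ x) τ = τ - ∫ r in (0 : ℝ)..τ, (if f θ x ≤ r then (1 : ℝ) else 0) := by
    intro x; rw [intervalIntegral_ite_le (hf x) hτ]; ring
  have hsum : ∀ Z : Finset 𝒳, ∑ x ∈ Z, min (f θ x) τ
      = #Z * τ - ∫ r in (0 : ℝ)..τ, ∑ x ∈ Z, (if f θ x ≤ r then (1 : ℝ) else 0) := by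
    intro Z
    rw [intervalIntegral.integral_finsetSum fun x _ => intervalIntegrable_ite_le _ _,
      Finset.sum_congr rfl fun x _ => hmin x, Finset.sum_sub_distrib, Finset.sum_const,
      nsmul_eq_mul]
  have hint : ∀ Z : Finset 𝒳, IntervalIntegrable
      (fun r : ℝ => ∑ x ∈ Z, (if f θ x ≤ r then (1 : ℝ) else 0)) MeasureTheory.volume 0 τ := by
    intro Z
    have := IntervalIntegrable.sum Z fun x _ => intervalIntegrable_ite_le (f θ x) τ
    simpa [Finset.sum_fn] using this
  -- The terms linear in `τ` cancel because the weights `n / |C|` give `C` total weight `n`.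
  have key : ∑ x ∈ X, 1 * min (f θ x) τ - ∑ x ∈ C, (X.card : ℝ) / C.card * min (f θ x) τ
      = -∫ r in (0 : ℝ)..τ, ((∑ x ∈ X, (if f θ x ≤ r then (1 : ℝ) else 0))
        - (X.card : ℝ) / C.card * ∑ x ∈ C, (if f θ x ≤ r then (1 : ℝ) else 0)) := by
    rw [intervalIntegral.integral_sub (hint X) ((hint C).const_mul _),
      intervalIntegral.integral_const_mul, ← Finset.mul_sum, ← Finset.mul_sum, hsum, hsum]
    field_simp
    ring
  rw [key, abs_neg, ← Real.norm_eq_abs]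
  refine (intervalIntegral.norm_integral_le_of_norm_le_const (C := δ * #X) fun r hr => ?_).trans_eq
    (by rw [sub_zero, abs_of_nonneg hτ])
  rw [Set.uIoc_of_le hτ] at hr
  have h1 := hdev {x | f θ x ≤ r} ⟨θ, r, hr.1.le, rfl⟩
  simp only [Set.mem_ofPred_eq] at h1
  rw [Finset.sum_boole, Finset.sum_boole, Real.norm_eq_abs]
  have h2 : (#{x ∈ X | f θ x ≤ r} : ℝ) - (X.card : ℝ) / C.card * #{x ∈ C | f θ x ≤ r}
      = ((#{x ∈ X | f θ x ≤ r} : ℝ) / #X - (#{x ∈ C | f θ x ≤ r} : ℝ) / #C) * #X := by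
    field_simp
  rw [h2, abs_mul, abs_of_pos hn]
  refine mul_le_mul_of_nonneg_right ?_ hn.le
  convert h1

/-- For each inequality the optimal `τ` of the smaller side is used as a multiplier for the larger
one. The sampling error `δ n τ` is offset by shifting `t` by `δ n`, and `hz` keeps `z - δ n`
nonnegative. -/
theorem IsDeltaSample.trimmedCost_le (hf : ∀ x, 0 ≤ f θ x) {C X : Finset 𝒳} {δ z : ℝ}
    (hδ : 0 ≤ δ) (hz : δ * #X ≤ z) (hC : IsDeltaSample (inducedRanges f) δ C X) :
    trimmedCost f (fun _ => 1) (z + δ * #X) θ X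
        ≤ trimmedCost f (fun _ => (#X : ℝ) / #C) z θ C ∧
      trimmedCost f (fun _ => (#X : ℝ) / #C) z θ C
        ≤ trimmedCost f (fun _ => 1) (z - δ * #X) θ X := by
  have hδn : 0 ≤ δ * #X := by positivity
  constructor
  · obtain ⟨τ, hτ, h1⟩ := exists_trimmedCost_le (w := fun _ => 1) (Y := X) (t := z + δ * #X)
      (fun x _ => hf x) (fun _ _ => zero_le_one) (by linarith)
    have h2 := le_trimmedCost (w := fun _ => (#X : ℝ) / #C) (Y := C) (t := z)
      (fun x _ => hf x) (fun _ _ => by positivity) (by linarith) hτ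
    have h3 := (abs_le.1 (hC.abs_sum_min_sub_le hf hτ)).2
    linarith
  · obtain ⟨τ, hτ, h1⟩ := exists_trimmedCost_le (w := fun _ => (#X : ℝ) / #C) (Y := C) (t := z)
      (fun x _ => hf x) (fun _ _ => by positivity) (by linarith)
    have h2 := le_trimmedCost (w := fun _ => 1) (Y := X) (t := z - δ * #X)
      (fun x _ => hf x) (fun _ _ => zero_le_one) (by linarith) hτ
    have h3 := (abs_le.1 (hC.abs_sum_min_sub_le hf hτ)).1
    linarith

theorem IsDeltaSample.isRobustCoreset (hf : ∀ θ x, 0 ≤ f θ x) {C X : Finset 𝒳} {β z : ℝ}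
    (hβ : 0 ≤ β) (hβ1 : β ≤ 1) (hz : 0 ≤ z)
    (hC : IsDeltaSample (inducedRanges f) (β * z / #X) C X) :
    IsRobustCoreset f z β 0 C (fun _ => (#X : ℝ) / #C) X := by
  intro θ
  have hn : (0 : ℝ) < #X := by exact_mod_cast (hC.2.1.mono hC.1).card_pos
  have h1 : β * z / #X * #X = β * z := div_mul_cancel₀ _ hn.ne'
  have h2 := hC.trimmedCost_le (z := z) (hf θ) (by positivity)
    (by rw [h1]; exact mul_le_of_le_one_left hz hβ1)
  rw [h1] at h2
  have h3 : (1 + β) * z = z + β * z := by ring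
  have h4 : (1 - β) * z = z - β * z := by ring
  rw [h3, h4]
  simpa using h2

end TrimmedCost

/-! ### Uniform samples are `δ`-samples. -/

section UniformSample

open Finset

open Classical in
/-- A uniform sample is representative for all members of a family of small VC dimension. -/
theorem card_deviating_le {α : Type*} [Fintype α] [DecidableEq α] (𝒮 : Finset (Finset α)) {d m : ℕ}
    (hd : 𝒮.vcDim ≤ d) (hd1 : 1 ≤ d) (hm : 1 ≤ m) (hm2 : m < Fintype.card α) {t l : ℝ}
    (ht : 0 ≤ t) (hl : 1 ≤ l) (htl : 2048 * m * (4 * d + l) ≤ t ^ 2) :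
    (#{C ∈ powersetCard m univ | ∃ A ∈ 𝒮, t < |(#(C ∩ A) : ℝ) - m * #A / Fintype.card α|} : ℝ)
      ≤ 4 * Real.exp (-l) * #(powersetCard m (univ : Finset α)) := by
  rcases le_or_gt (2 * m) (Fintype.card α) with h | h
  · exact card_deviating_le_of_two_mul_le 𝒮 hd hd1 hm h ht hl htl
  have hmm : ((Fintype.card α - m : ℕ) : ℝ) ≤ m := by exact_mod_cast (by omega)
  have hn : (0 : ℝ) < Fintype.card α := by exact_mod_cast (by omega)
  -- The deviation of `Cᶜ` is minus that of `C`, and `Cᶜ` has `n - m < m` points, so the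
  -- small-sample case applies to complements.
  have hcompl := card_deviating_le_of_two_mul_le 𝒮 (m := Fintype.card α - m) hd hd1 (by omega)
    (by omega) ht hl (by
      refine le_trans ?_ htl
      gcongr)
  rw [Finset.card_powersetCard, Finset.card_univ, Nat.choose_symm hm2.le] at hcompl
  rw [Finset.card_powersetCard, Finset.card_univ]
  refine le_trans ?_ hcompl
  refine Nat.cast_le.2 ?_
  refine Finset.card_le_card_of_injOn compl (fun C hC => ?_) compl_injective.injOn
  obtain ⟨hC, A, hA, h1⟩ := Finset.mem_filter.1 (Finset.mem_coe.1 hC)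
  have hCm : #C = m := (Finset.mem_powersetCard.1 hC).2
  refine Finset.mem_coe.2 (Finset.mem_filter.2 ⟨?_, A, hA, ?_⟩)
  · rw [Finset.mem_powersetCard, Finset.card_compl, hCm]
    exact ⟨Finset.subset_univ _, rfl⟩
  · have h2 : (#(Cᶜ ∩ A) : ℝ) = #A - #(C ∩ A) := by
      have h3 := Finset.card_inter_add_card_sdiff A C
      rw [Finset.inter_comm A C] at h3
      have h4 : Cᶜ ∩ A = A \ C := by
        ext x; simp [and_comm]
      rw [h4, eq_sub_iff_add_eq, add_comm]
      exact_mod_cast h3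
    rw [h2, Nat.cast_sub hm2.le]
    have h3 : (#A : ℝ) - #(C ∩ A) - (Fintype.card α - m) * #A / Fintype.card α
        = -((#(C ∩ A) : ℝ) - m * #A / Fintype.card α) := by
      field_simp
      ring
    rwa [h3, abs_neg]

variable {𝒳 : Type*} {𝓡 : Set (Set 𝒳)}

theorem ShatteredBy.card_le {d : ℕ} {S : Finset 𝒳} (hS : ShatteredBy 𝓡 S)
    (hd : rangeVCDim 𝓡 = d) : #S ≤ d := by
  have h1 : (#S : ℕ∞) ≤ rangeVCDim 𝓡 :=
    le_iSup₂ (f := fun (S : Finset 𝒳) (_ : ShatteredBy 𝓡 S) => (#S : ℕ∞)) S hS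
  rw [hd] at h1
  exact_mod_cast h1

open Classical in
/-- The traces of the ranges on a finite set have at most the VC dimension of the range space. -/
theorem vcDim_traces_le (X : Finset 𝒳) {d : ℕ} (hd : rangeVCDim 𝓡 = d) :
    ({A : Finset X | ∃ R ∈ 𝓡, ∀ x, x ∈ A ↔ (x : 𝒳) ∈ R} : Finset (Finset X)).vcDim ≤ d := by
  unfold Finset.vcDim
  refine Finset.sup_le fun S hS => ?_
  rw [Finset.mem_shatterer] at hS
  rw [← Finset.card_map (Function.Embedding.subtype _)]
  refine ShatteredBy.card_le (fun T hT => ?_) hd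
  obtain ⟨A, hA, hSA⟩ := hS (Finset.filter_subset (fun x : X => (x : 𝒳) ∈ T) S)
  obtain ⟨R, hR, hAR⟩ := (Finset.mem_filter.1 hA).2
  refine ⟨R, hR, ?_⟩
  ext y
  simp only [Set.mem_inter_iff, Finset.mem_coe, Finset.mem_map]
  have key : ∀ x ∈ S, (x : 𝒳) ∈ R ↔ (x : 𝒳) ∈ T := by
    intro x hx
    have := Finset.ext_iff.1 hSA x
    simp only [Finset.mem_inter, Finset.mem_filter, hx, true_and, hAR] at this
    exact this
  constructor
  · rintro ⟨⟨x, hx, rfl⟩, hy⟩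
    exact (key x hx).1 hy
  · intro hy
    obtain ⟨x, hx, rfl⟩ := Finset.mem_map.1 (hT hy)
    exact ⟨⟨x, hx, rfl⟩, (key x hx).2 hy⟩

open Classical in
/-- Few samples fail to be `δ`-samples. -/
theorem card_not_isDeltaSample_le {X : Finset 𝒳} {d m : ℕ} (hd : rangeVCDim 𝓡 = d) (hd1 : 1 ≤ d)
    (hm : 1 ≤ m) (hm2 : m < #X) {δ η : ℝ} (hδ : 0 ≤ δ) (hη : 0 < η) (hη1 : η < 1)
    (h : 12288 * (d + Real.log (1 / η)) ≤ δ ^ 2 * m) :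
    (#{C ∈ X.powersetCard m | ¬ IsDeltaSample 𝓡 δ C X} : ℝ) ≤ η * #(X.powersetCard m) := by
  set 𝒮 : Finset (Finset X) := {A : Finset X | ∃ R ∈ 𝓡, ∀ x, x ∈ A ↔ (x : 𝒳) ∈ R} with h𝒮
  have hm0 : (1 : ℝ) ≤ m := by exact_mod_cast hm
  have hd0 : (1 : ℝ) ≤ d := by exact_mod_cast hd1
  have hlog : 0 < Real.log (1 / η) := Real.log_pos (by rw [lt_div_iff₀ hη]; linarith)
  -- The extra `2` in `l` pays for the factor `4`, since `exp 2 ≥ 4`. As `d ≥ 1`, `4 d + l ≤ 6 (d +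
  -- log (1 / η))`, and `2048 * 6 = 12288`.
  have hmain := card_deviating_le 𝒮 (vcDim_traces_le X hd) hd1 hm
    (by rwa [Fintype.card_coe]) (t := δ * m) (l := Real.log (1 / η) + 2) (by positivity)
    (by linarith) (by
      calc 2048 * (m : ℝ) * (4 * d + (Real.log (1 / η) + 2))
          ≤ 2048 * m * (6 * (d + Real.log (1 / η))) := by gcongr; linarith
        _ = m * (12288 * (d + Real.log (1 / η))) := by ring
        _ ≤ m * (δ ^ 2 * m) := by gcongr
        _ = _ := by ring)
  have hexp : 4 * Real.exp (-(Real.log (1 / η) + 2)) ≤ η := by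
    rw [neg_add, Real.exp_add, one_div, Real.log_inv, neg_neg, Real.exp_log hη, Real.exp_neg]
    have h1 : (4 : ℝ) ≤ Real.exp 2 := by
      have h2 := Real.add_one_le_exp (1 : ℝ)
      have h3 : Real.exp 2 = Real.exp 1 * Real.exp 1 := by rw [← Real.exp_add]; norm_num
      rw [h3]; nlinarith
    have h2 : 4 * (Real.exp 2)⁻¹ ≤ 1 := by
      rw [← div_eq_mul_inv, div_le_one (Real.exp_pos _)]; exact h1
    nlinarith
  have hpc : #(powersetCard m (univ : Finset X)) = #(X.powersetCard m) := by
    rw [Finset.card_powersetCard, Finset.card_powersetCard, Finset.card_univ, Fintype.card_coe]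
  rw [hpc] at hmain
  refine le_trans ?_ (hmain.trans (mul_le_mul_of_nonneg_right hexp (Nat.cast_nonneg _)))
  refine Nat.cast_le.2 ?_
  refine Finset.card_le_card_of_injOn (fun C => ({x : X | (x : 𝒳) ∈ C} : Finset X)) ?_ ?_
  · intro C hC
    obtain ⟨hC, hnot⟩ := Finset.mem_filter.1 (Finset.mem_coe.1 hC)
    obtain ⟨hCX, hCm⟩ := Finset.mem_powersetCard.1 hC
    have hfil : ∀ p : 𝒳 → Prop, ∀ Z ⊆ X,
        #({x : X | (x : 𝒳) ∈ Z ∧ p x} : Finset X) = #{x ∈ Z | p x} := by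
      intro p Z hZ
      rw [← Finset.card_map (Function.Embedding.subtype _)]
      congr 1
      ext x
      simp only [Finset.mem_map, Finset.mem_filter, Finset.mem_univ, true_and]
      constructor
      · rintro ⟨y, hy, rfl⟩
        exact hy
      · intro hx
        exact ⟨⟨x, hZ hx.1⟩, hx, rfl⟩
    have hCne : C.Nonempty := Finset.card_pos.1 (by omega)
    have hex : ∃ R ∈ 𝓡, δ <
        |(#{x ∈ X | x ∈ R} : ℝ) / #X - (#{x ∈ C | x ∈ R} : ℝ) / #C| := by
      by_contra! hcon
      exact hnot ⟨hCX, hCne, hcon⟩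
    obtain ⟨R, hR, hdev⟩ := hex
    refine Finset.mem_coe.2 (Finset.mem_filter.2 ⟨?_, ({x : X | (x : 𝒳) ∈ R} : Finset X), ?_, ?_⟩)
    · rw [Finset.mem_powersetCard]
      refine ⟨Finset.subset_univ _, ?_⟩
      have := hfil (fun _ => True) C hCX
      simpa [hCm] using this
    · exact Finset.mem_filter.2 ⟨Finset.mem_univ _, R, hR, fun x => by simp⟩
    · have h1 := hfil (· ∈ R) C hCX
      have h2 := hfil (· ∈ R) X subset_rfl
      have h2' : #({x : X | (x : 𝒳) ∈ R} : Finset X) = #{x ∈ X | x ∈ R} := by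
        rw [← h2]; congr 1; ext x; simp
      rw [← Finset.filter_and, h1, h2', Fintype.card_coe]
      rw [hCm] at hdev
      have hn : (0 : ℝ) < #X := by exact_mod_cast (by omega)
      have h3 : (#{x ∈ C | x ∈ R} : ℝ) - m * #{x ∈ X | x ∈ R} / #X
          = -(((#{x ∈ X | x ∈ R} : ℝ) / #X - (#{x ∈ C | x ∈ R} : ℝ) / m) * m) := by
        field_simp
        ring
      rw [h3, abs_neg, abs_mul, abs_of_pos (by positivity : (0 : ℝ) < m)]
      exact mul_lt_mul_of_pos_right hdev (by positivity)
  · intro C hC C' hC' hCC'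
    have hCX := (Finset.mem_powersetCard.1 (Finset.mem_filter.1 (Finset.mem_coe.1 hC)).1).1
    have hCX' := (Finset.mem_powersetCard.1 (Finset.mem_filter.1 (Finset.mem_coe.1 hC')).1).1
    ext x
    have key : ∀ hx : x ∈ X, x ∈ C ↔ x ∈ C' := fun hx => by
      have := Finset.ext_iff.1 hCC' ⟨x, hx⟩
      simpa using this
    exact ⟨fun hx => (key (hCX hx)).1 hx, fun hx => (key (hCX' hx)).2 hx⟩

theorem isDeltaSample_self {X : Finset 𝒳} (hX : X.Nonempty) {δ : ℝ} (hδ : 0 ≤ δ) :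
    IsDeltaSample 𝓡 δ X X :=
  ⟨subset_rfl, hX, fun R _ => by simpa using hδ⟩

/-- In VC dimension zero, the ranges do not distinguish any items. -/
theorem isDeltaSample_of_rangeVCDim_eq_zero {Θ : Type*} {f : Θ → 𝒳 → ℝ} (hf : ∀ θ x, 0 ≤ f θ x)
    (h0 : rangeVCDim (inducedRanges f) = 0) {C X : Finset 𝒳} (hCX : C ⊆ X) (hC : C.Nonempty)
    {δ : ℝ} (hδ : 0 ≤ δ) : IsDeltaSample (inducedRanges f) δ C X := by
  classical
  have hall : ∀ R ∈ inducedRanges f, ∀ x, x ∈ R := by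
    rintro R ⟨θ, r, hr, rfl⟩ x
    by_contra hx
    -- If a range misses `x`, then `{x}` is shattered, because the range of radius `f θ x` contains
    -- it.
    have hsh : ShatteredBy (inducedRanges f) {x} := by
      intro T hT
      rcases Finset.subset_singleton_iff.1 hT with rfl | rfl
      · exact ⟨_, ⟨θ, r, hr, rfl⟩, by
          rw [Finset.coe_singleton, Set.singleton_inter_eq_empty.2 hx]; simp⟩
      · exact ⟨_, ⟨θ, f θ x, hf θ x, rfl⟩, by simp⟩
    have := hsh.card_le (d := 0) (by simpa using h0)
    simp at this
  refine ⟨hCX, hC, fun R hR => ?_⟩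
  have h1 : (#C : ℝ) ≠ 0 := by exact_mod_cast hC.card_pos.ne'
  have h2 : (#X : ℝ) ≠ 0 := by exact_mod_cast (hC.mono hCX).card_pos.ne'
  rw [Finset.filter_true_of_mem fun x _ => hall R hR x,
    Finset.filter_true_of_mem fun x _ => hall R hR x, div_self h1, div_self h2]
  simpa using hδ

open Classical in
theorem one_sub_le_uniformSampleProb {X : Finset 𝒳} {m : ℕ} (hm : m ≤ #X) {p : Finset 𝒳 → Prop}
    {η : ℝ} (h : (#{C ∈ X.powersetCard m | ¬ p C} : ℝ) ≤ η * #(X.powersetCard m)) :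
    1 - η ≤ uniformSampleProb X m p := by
  have hpos : (0 : ℝ) < #(X.powersetCard m) := by
    exact_mod_cast (Finset.powersetCard_nonempty.2 hm).card_pos
  have hsplit : (#{C ∈ X.powersetCard m | p C} : ℝ) + #{C ∈ X.powersetCard m | ¬ p C}
      = #(X.powersetCard m) := by
    exact_mod_cast Finset.card_filter_add_card_filter_not (s := X.powersetCard m) p
  unfold uniformSampleProb
  rw [le_div_iff₀ hpos]
  linarith

open Classical in
/-- A uniform sample of size `K δ⁻² (d + log (1 / η))`, or a full sample, is a `δ`-sample. -/
theorem card_not_isDeltaSample_inducedRanges_le {Θ : Type*} {f : Θ → 𝒳 → ℝ}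
    (hf : ∀ θ x, 0 ≤ f θ x) {X : Finset 𝒳} {d m : ℕ} (hd : rangeVCDim (inducedRanges f) = d)
    (hm : 1 ≤ m) (hm2 : m ≤ #X) {δ η : ℝ} (hδ : 0 ≤ δ) (hη : 0 < η) (hη1 : η < 1)
    (h : m < #X → 12288 * (d + Real.log (1 / η)) ≤ δ ^ 2 * m) :
    (#{C ∈ X.powersetCard m | ¬ IsDeltaSample (inducedRanges f) δ C X} : ℝ)
      ≤ η * #(X.powersetCard m) := by
  -- Outside this case no `m`-subset fails: either the ranges contain every item, or `C = X`.
  by_cases hcase : 1 ≤ d ∧ m < #X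
  · exact card_not_isDeltaSample_le hd hcase.1 hm hcase.2 hδ hη hη1 (h hcase.2)
  · have hnone : ({C ∈ X.powersetCard m | ¬ IsDeltaSample (inducedRanges f) δ C X}) = ∅ := by
      refine Finset.filter_eq_empty_iff.2 fun C hC => not_not.2 ?_
      obtain ⟨hCX, hCm⟩ := Finset.mem_powersetCard.1 hC
      have hCne : C.Nonempty := Finset.card_pos.1 (by omega)
      rcases Nat.eq_zero_or_pos d with rfl | hd1
      · exact isDeltaSample_of_rangeVCDim_eq_zero hf (by simpa using hd) hCX hCne hδ
      · have hCX' : C = X := Finset.eq_of_subset_of_card_le hCX (by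
          rw [hCm]; by_contra! hlt; exact hcase ⟨hd1, hlt⟩)
        subst hCX'
        exact isDeltaSample_self hCne hδ
    rw [hnone, Finset.card_empty, Nat.cast_zero]
    positivity

end UniformSample

/-! ### The main theorem. -/

theorem theorem1 :
    ∃ K : ℝ, 0 < K ∧
      ∀ (Θ : Type*) (𝒳 : Type*) (f : Θ → 𝒳 → ℝ), (∀ θ x, 0 ≤ f θ x) →
      ∀ (X : Finset 𝒳) (z : ℕ), 0 < z → z ≤ X.card →
        -- every δ-sample with equal weights n / |C| approximates the trimmed objective
        (∀ (δ : ℝ) (C : Finset 𝒳), 0 < δ → δ ≤ (z : ℝ) / X.card →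
          IsDeltaSample (inducedRanges f) δ C X →
          ∀ θ : Θ,
            trimmedCost f (fun _ => 1) (z + δ * X.card) θ X
                ≤ trimmedCost f (fun _ => (X.card : ℝ) / C.card) z θ C ∧
              trimmedCost f (fun _ => (X.card : ℝ) / C.card) z θ C
                ≤ trimmedCost f (fun _ => 1) (z - δ * X.card) θ X) ∧
        ∀ β : ℝ, 0 < β → β < 1 →
          -- for δ = β z / n it is a (β, 0)-robust coreset
          (∀ C : Finset 𝒳, IsDeltaSample (inducedRanges f) (β * z / X.card) C X →
            IsRobustCoreset f z β 0 C (fun _ => (X.card : ℝ) / C.card) X) ∧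
          -- and a uniform sample of the claimed size is one with probability at least 1 - η
          ∀ (η : ℝ) (d m : ℕ), 0 < η → η < 1 → rangeVCDim (inducedRanges f) = d →
            m ≤ X.card →
            min (X.card : ℝ)
                (K * (1 / β ^ 2) * ((X.card : ℝ) / z) ^ 2 * (d + Real.log (1 / η))) ≤ m →
            1 - η ≤ uniformSampleProb X m (fun C =>
              IsDeltaSample (inducedRanges f) (β * z / X.card) C X ∧
                IsRobustCoreset f z β 0 C (fun _ => (X.card : ℝ) / C.card) X) := by
  refine ⟨12288, by norm_num, fun Θ 𝒳 f hf X z hz hzX => ?_⟩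
  have hn : (0 : ℝ) < X.card := by exact_mod_cast hz.trans_le hzX
  have hz0 : (0 : ℝ) < z := by exact_mod_cast hz
  refine ⟨fun δ C hδ hδz hC θ => hC.trimmedCost_le (hf θ) hδ.le ((le_div_iff₀ hn).1 hδz), ?_⟩
  intro β hβ hβ1
  refine ⟨fun C hC => hC.isRobustCoreset hf hβ.le hβ1.le hz0.le, ?_⟩
  intro η d m hη hη1 hd hmX hm
  have hlog : 0 < Real.log (1 / η) := Real.log_pos (by rw [lt_div_iff₀ hη]; linarith)
  -- The required size is positive since `log (1 / η) > 0`, even for `d = 0`; hence samples are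
  -- nonempty.
  have hm0 : 1 ≤ m := by
    have h1 : (0 : ℝ) < m := lt_of_lt_of_le (lt_min hn (by positivity)) hm
    exact_mod_cast h1
  classical
  refine one_sub_le_uniformSampleProb hmX (le_trans ?_
    (card_not_isDeltaSample_inducedRanges_le hf hd hm0 hmX (δ := β * z / X.card)
      (by positivity) hη hη1 fun hlt => ?_))
  · norm_cast
    refine Finset.card_le_card fun C hC => ?_
    rw [Finset.mem_filter] at hC ⊢
    exact ⟨hC.1, fun h => hC.2 ⟨h, h.isRobustCoreset hf hβ.le hβ1.le hz0.le⟩⟩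
  · have h1 := (min_le_iff.1 hm).resolve_left (not_le.2 (by exact_mod_cast hlt))
    calc 12288 * (d + Real.log (1 / η))
        = (β * z / X.card) ^ 2 * (12288 * (1 / β ^ 2) * ((X.card : ℝ) / z) ^ 2
            * (d + Real.log (1 / η))) := by field_simp
      _ ≤ _ := by gcongr
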